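/- **Setting.** Let $1\le M<N$. For each $n\in\{1,\dots,N\}$ consider a linear process $x_n(t+1)=A_nx_n(t)+w_n(t)$, measured as $y_n(t)=C_nx_n(t)+z_n(t)$, where $w_n,z_n$ are i.i.d. zero-mean Gaussian with covariances $W_n,Z_n$. Sensor $n$ runs a local Kalman filter which is stable and in steady state: its error covariance is a positive semidefinite matrix $\bar P_n$ with $\bar P_n=(I-K_nC_n)P_n^-$, where $P_n^-=A_n\bar P_nA_n^\top+W_n$, $K_n=P_n^-C_n^\top(C_nP_n^-C_n^\top+Z_n)^{-1}$ (the inverse exists), and $\rho((I-K_nC_n)A_n)<1$; here $\rho$ denotes the spectral radius. Put $\theta_n(X)=A_nXA_n^\top+W_n$ and $c_n(i)=\operatorname{Tr}(\theta_n^{i}(\bar P_n))$. *Channel.* There are $M$ frequencies, and frequency $m$ has finitely many quality levels $\mathcal H_m$. The quality state $h\in\mathcal S=\prod_m\mathcal H_m$ is a semi-Markov chain with transition probabilities $[\mathbf M]_{h,h'}$ at the transition instants and, independently of the next state, holding period distribution $\psi_h$ on $\{1,\dots,\bar\Delta\}$. Adjoining the time $\delta$ for which the current state has been held gives a Markov chain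 $\tilde h(t)=(h(t),\delta(t))$ on $\tilde{\mathcal S}=\mathcal S\times\{1,\dots,\bar\Delta\}$ with transition matrix $$[\tilde M]_{(h,\delta),(h',\delta')}=\begin{cases}[\mathbf M]_{h,h'}\,r_h(\delta)&\text{if }\delta'=1,\\ 1-r_h(\delta)&\text{if }\delta'=\delta+1\le\bar\Delta,\ h'=h,\\ 0&\text{otherwise,}\end{cases}\qquad r_h(\delta)=\frac{\psi_h(\delta)}{\sum_{k=\delta}^{\bar\Delta}\psi_h(k)},$$ which is assumed irreducible and aperiodic. Its initial distribution is arbitrary. Given the channel states, the transmission outcomes at different times are independent, with a law at time $t$ that depends only on $\tilde h(t)$; a packet sent at frequency $m$ in channel state $i$ is dropped with probability $d_{i,m}\in[0,1]$. (The outcomes at different frequencies in the same time slot may have any joint law.) *Scheduling.* The gateway knows $\tilde h(t)$ before it schedules. A scheduling policy is deterministic and stationary: it is a map from $(\phi(t),\tilde h(t))$ to an assignment that gives each sensor one frequency or none, with no frequency given to two sensors. Here $\phi(t)=(\phi_1(t),\dots,\phi_N(t))$ is the vector of ages of information: $\phi_n(t+1)=1$ if the packet of sensor $n$ is received at time $t$,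 and $\phi_n(t+1)=\phi_n(t)+1$ otherwise; $\phi(0)$ is an arbitrary vector of positive integers. The policy makes the remote estimator average mean-square stable if $J=\sum_{n=1}^NJ_n<\infty$, where $$J_n=\limsup_{T\to\infty}\frac1T\sum_{t=1}^T\mathsf E\big[c_n(\phi_n(t))\big].$$ **Theorem.** Let $\rho_{\max}=\max_n\rho(A_n)$. For each channel state $i\in\tilde{\mathcal S}$ let $v_i^\star\in\operatorname{argmin}_{1\le m\le M}d_{i,m}$, and let $V(v^\star)$ be the diagonal matrix with entries $d_{i,v_i^\star}$. There is a scheduling policy that makes the remote estimator average mean-square stable if and only if $$\rho_{\max}^2\,\rho\big(V(v^\star)\tilde M\big)<1.$$ -/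

import Mathlib

open MeasureTheory Filter
open scoped ENNReal Matrix

namespace RemoteEstimation

/-! ### Processes and local Kalman filters -/

/-- A linear time-invariant process `x(t+1) = A x(t) + w(t)`, `y(t) = C x(t) + z(t)` with noise
covariances `W`, `Z`, together with the steady-state (updated) error covariance `Pbar` of its local
Kalman filter. -/
structure LTIProcess where
  l : ℕ
  r : ℕ
  A : Matrix (Fin l) (Fin l) ℝ
  C : Matrix (Fin r) (Fin l) ℝ
  W : Matrix (Fin l) (Fin l) ℝ
  Z : Matrix (Fin r) (Fin r) ℝ
  Pbar : Matrix (Fin l) (Fin l) ℝ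
  W_psd : W.PosSemidef
  Z_psd : Z.PosSemidef
  Pbar_psd : Pbar.PosSemidef

/-- Spectral radius of a real square matrix (largest modulus of its complex eigenvalues). -/
noncomputable def specRad {ι : Type*} [Fintype ι] [DecidableEq ι] (B : Matrix ι ι ℝ) : ℝ≥0∞ :=
  spectralRadius ℂ (B.map (algebraMap ℝ ℂ))

namespace LTIProcess

variable (p : LTIProcess)

/-- The map `θ(X) = A X Aᵀ + W`. -/
def theta (X : Matrix (Fin p.l) (Fin p.l) ℝ) : Matrix (Fin p.l) (Fin p.l) ℝ :=
  p.A * X * p.Aᵀ + p.W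

/-- The innovation covariance `C P(t|t-1) Cᵀ + Z`, with `P(t|t-1) = A Pbar Aᵀ + W`. -/
def innovCov : Matrix (Fin p.r) (Fin p.r) ℝ :=
  p.C * p.theta p.Pbar * p.Cᵀ + p.Z

/-- The steady-state Kalman gain. -/
noncomputable def gain : Matrix (Fin p.l) (Fin p.r) ℝ :=
  p.theta p.Pbar * p.Cᵀ * (p.innovCov)⁻¹

/-- The local Kalman filter is stable and in steady state: the gain is well defined, `Pbar` is a
fixed point of the covariance recursion, and the matrix `(I - K C) A` of the error dynamics
`e(t) = (I - K C) A e(t-1) + noise` has all its eigenvalues in the open unit disc. -/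
structure StableSteadyKalman : Prop where
  innov_unit : IsUnit p.innovCov.det
  fixed : p.Pbar = (1 - p.gain * p.C) * p.theta p.Pbar
  stable : specRad ((1 - p.gain * p.C) * p.A) < 1

/-- The estimation cost `c(i) = Tr(θ^i(Pbar))` at age of information `i`. -/
def cost (i : ℕ) : ℝ := ((p.theta)^[i] p.Pbar).trace

end LTIProcess

/-! ### The semi-Markov channel -/

/-- Channel quality states: frequency `m` has `L m` quality levels. -/
abbrev QState {M : ℕ} (L : Fin M → ℕ) : Type := ∀ m : Fin M, Fin (L m)

/-- Channel states: quality state and holding time. The element `k : Fin D` is the holding time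
`k + 1`, so that holding times range over `{1, …, D}`. -/
abbrev ChState {M : ℕ} (L : Fin M → ℕ) (D : ℕ) : Type := QState L × Fin D

/-- Statistics of a semi-Markov fading channel with `M` frequencies, `L m` quality levels at
frequency `m`, and holding periods bounded by `D`. -/
structure SemiMarkovChannel (M : ℕ) (L : Fin M → ℕ) (D : ℕ) where
  /-- transition probabilities of the quality state at the transition instants -/
  trans : Matrix (QState L) (QState L) ℝ
  trans_nonneg : ∀ i j, 0 ≤ trans i j
  trans_sum : ∀ i, ∑ j, trans i j = 1
  /-- distribution of the holding period, given the quality state -/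
  hold : QState L → Fin D → ℝ
  hold_nonneg : ∀ i k, 0 ≤ hold i k
  hold_sum : ∀ i, ∑ k, hold i k = 1
  /-- joint distribution of the transmission outcomes at the `M` frequencies (`true` is success),
  given the channel state -/
  outcome : ChState L D → (Fin M → Bool) → ℝ
  outcome_nonneg : ∀ i o, 0 ≤ outcome i o
  outcome_sum : ∀ i, ∑ o, outcome i o = 1

namespace SemiMarkovChannel

variable {M : ℕ} {L : Fin M → ℕ} {D : ℕ} (ch : SemiMarkovChannel M L D)

/-- The packet drop probability at frequency `m` in channel state `i`. -/
def drop (i : ChState L D) (m : Fin M) : ℝ :=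
  ∑ o : Fin M → Bool, if o m = false then ch.outcome i o else 0

/-- The probability that the holding period ends, given that it has lasted for time `k`. -/
noncomputable def hazard (i : QState L) (k : Fin D) : ℝ :=
  ch.hold i k / ∑ k' ∈ Finset.Ici k, ch.hold i k'

/-- The transition matrix of the Markov chain (quality state, holding time). -/
noncomputable def augMatrix : Matrix (ChState L D) (ChState L D) ℝ := fun i j =>
  if (j.2 : ℕ) = 0 then ch.trans i.1 j.1 * ch.hazard i.1 i.2
  else if (j.2 : ℕ) = (i.2 : ℕ) + 1 ∧ j.1 = i.1 then 1 - ch.hazard i.1 i.2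
  else 0

/-- The diagonal matrix of packet drop probabilities under the frequency selection `v`. -/
def dropMatrix (v : ChState L D → Fin M) : Matrix (ChState L D) (ChState L D) ℝ :=
  Matrix.diagonal fun i => ch.drop i (v i)

/-- The random processes `h t` (channel state) and `μ t` (transmission outcomes at the `M`
frequencies) on a probability space `(Ω, P)` follow the statistics `ch`: `h` is a Markov chain with
transition matrix `ch.augMatrix`, and, given `h`, the outcomes at different times are independent
and the outcome at time `t` has distribution `ch.outcome (h t)`. The initial distribution of the
channel state is arbitrary. -/
structure IsRealization {Ω : Type*} [MeasurableSpace Ω] (P : Measure Ω)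
    (h : ℕ → Ω → ChState L D) (μ : ℕ → Ω → Fin M → Bool) : Prop where
  measurable_state : ∀ t, Measurable (h t)
  measurable_outcome : ∀ t, Measurable (μ t)
  law : ∀ (T : ℕ) (x : ℕ → ChState L D) (o : ℕ → Fin M → Bool),
    P {ω | ∀ t ≤ T, h t ω = x t ∧ μ t ω = o t} =
      P {ω | h 0 ω = x 0} *
        ENNReal.ofReal ((∏ t ∈ Finset.range T, ch.augMatrix (x t) (x (t + 1))) *
          ∏ t ∈ Finset.range (T + 1), ch.outcome (x t) (o t))

end SemiMarkovChannel

/-- Aperiodicity of a Markov chain with transition matrix `B`: for each state, the possible return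
times have no common divisor other than 1. -/
def Aperiodic {ι : Type*} [Fintype ι] [DecidableEq ι] (B : Matrix ι ι ℝ) : Prop :=
  ∀ i, ∀ d : ℕ, (∀ k, 0 < k → 0 < (B ^ k) i i → d ∣ k) → d = 1

/-! ### Scheduling, age of information and stability -/

/-- A deterministic stationary scheduling policy for `N` sensors and `M` frequencies. From the
vector of ages of information and the current channel state, it gives each sensor a frequency or
leaves it unscheduled (`none`); no frequency is given to two sensors. -/
structure Policy (N M : ℕ) (L : Fin M → ℕ) (D : ℕ) where
  act : (Fin N → ℕ) → ChState L D → Fin N → Option (Fin M)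
  feasible : ∀ φ i n n' m, act φ i n = some m → act φ i n' = some m → n = n'

section Dynamics

variable {N M : ℕ} {L : Fin M → ℕ} {D : ℕ} {Ω : Type*}

/-- Whether a sensor's packet is received, given its scheduling action and the outcomes at the
`M` frequencies. -/
def received (a : Option (Fin M)) (o : Fin M → Bool) : Bool :=
  match a with
  | none => false
  | some m => o m

/-- The ages of information `φ_n(t)` under the policy `π`, started at `φ₀`. -/
def aoi (π : Policy N M L D) (h : ℕ → Ω → ChState L D) (μ : ℕ → Ω → Fin M → Bool)
    (φ₀ : Fin N → ℕ) : ℕ → Ω → Fin N → ℕ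
  | 0, _, n => φ₀ n
  | t + 1, ω, n =>
    if received (π.act (aoi π h μ φ₀ t ω) (h t ω) n) (μ t ω) = true then 1
    else aoi π h μ φ₀ t ω n + 1

variable [MeasurableSpace Ω]

/-- The long-term average mean-square estimation error `J_n` of process `n`, the expectation being
over the channel states and the transmission outcomes. -/
noncomputable def avgCost (proc : Fin N → LTIProcess) (P : Measure Ω) (π : Policy N M L D)
    (h : ℕ → Ω → ChState L D) (μ : ℕ → Ω → Fin M → Bool) (φ₀ : Fin N → ℕ) (n : Fin N) : ℝ≥0∞ :=
  limsup (fun T : ℕ => (T : ℝ≥0∞)⁻¹ * ∑ t ∈ Finset.Icc 1 T,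
    ∫⁻ ω, ENNReal.ofReal ((proc n).cost (aoi π h μ φ₀ t ω n)) ∂P) atTop

/-- Average mean-square stability: the sum `J` of the long-term average costs is finite. -/
def AvgMeanSquareStable (proc : Fin N → LTIProcess) (P : Measure Ω) (π : Policy N M L D)
    (h : ℕ → Ω → ChState L D) (μ : ℕ → Ω → Fin M → Bool) (φ₀ : Fin N → ℕ) : Prop :=
  ∑ n, avgCost proc P π h μ φ₀ n < ⊤

end Dynamics

end RemoteEstimation

/-!
Write `B = V(v) M̃` for the matrix of failures under the best frequency in each channel state, `β` for
its spectral radius, and `c_n` for the estimation cost of sensor `n` as a function of its age. Both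
directions are drift arguments for a function of the ages and the channel state, and rest on a
one-step formula for expectations along a realization
(`SemiMarkovChannel.IsRealization.lintegral_step`).

*Sufficiency.* If `ρ_max² β < 1`, choose `r > ρ_max²` with `r β < 1`. The costs are `O(1 + r ^ φ)`
(`LTIProcess.exists_cost_le`, from Gelfand's formula), so it is enough to bound `E r ^ φ_n(t)`
uniformly in `t`. The policy `oldestFirst` sends only the packet of a sensor of largest age, at the
best frequency. Then the sensors are served in a queue: every success either serves sensor `n`, or
lowers by one the number `k` of sensors at least as old as `n`, while a failure leaves `k`
unchanged. Since `r β < 1`, there is a vector `y ≥ 1` with `r B y + 1 ≤ y`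
(`exists_strict_superinvariant`). For `Λ` large, `r ^ φ_n * Λ ^ k * y` contracts up to an additive
constant in each slot (`queueWeight_drift`): failures are controlled by `y`, successes of other
sensors by the factor `Λ⁻¹`, and a success of sensor `n` resets the function to a bounded value.

*Necessity.* Suppose `ρ_max² β ≥ 1`. Since `β ≤ 1`, a sensor `n` with `ρ(A_n) = ρ_max` has
`ρ(A_n) ≥ 1`. Stability of its local Kalman filter forces the dominant mode of `A_n` to be excited, by
the process noise if the mode is on the unit circle, and so `c_n(φ)` is at least a positive
multiple of `a(φ) = ∑_{j < φ} ρ_max ^ (2 j)` (`LTIProcess.exists_le_cost`). The entrywise modulus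
`x` of a dominant eigenvector of `B` satisfies `B x ≥ β x` (`exists_subinvariant`). Whatever the
policy does, the packet of sensor `n` is lost with at least the probability in `B`, and
`a(φ + 1) = ρ_max² a(φ) + 1`; hence the expectation of `a(φ_n(t)) x(h̃(t))` grows in each slot by at
least `β E x(h̃(t))` (`weighted_geom_sum_drift`). These increments have infinite sum as the channel
is irreducible (`SemiMarkovChannel.IsRealization.tendsto_sum_lintegral`), so the expected costs, and
with them their averages, tend to infinity.
-/

namespace RemoteEstimation

/-! ### Spectral radius of real matrices -/

section Spectral

variable {ι : Type*} [Fintype ι] [DecidableEq ι]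

theorem mem_spectrum_iff_det (B : Matrix ι ι ℂ) (z : ℂ) :
    z ∈ spectrum ℂ B ↔ (z • (1 : Matrix ι ι ℂ) - B).det = 0 := by
  rw [spectrum.mem_iff, Matrix.isUnit_iff_isUnit_det, isUnit_iff_ne_zero, not_not,
    Algebra.algebraMap_eq_smul_one]

theorem specRad_of_isEmpty [IsEmpty ι] (B : Matrix ι ι ℝ) : specRad B = 0 := by
  refine le_antisymm (iSup₂_le fun z hz => ?_) zero_le
  rw [mem_spectrum_iff_det] at hz
  simp at hz

theorem nnnorm_le_specRad_of_vecMul (B : Matrix ι ι ℝ) (z : ℂ) (u : ι → ℂ) (hu : u ≠ 0)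
    (h : u ᵥ* B.map (algebraMap ℝ ℂ) = z • u) : (‖z‖₊ : ℝ≥0∞) ≤ specRad B := by
  have hz : z ∈ spectrum ℂ (B.map (algebraMap ℝ ℂ)) := by
    rw [mem_spectrum_iff_det, ← Matrix.exists_vecMul_eq_zero_iff]
    exact ⟨u, hu, by rw [Matrix.vecMul_sub, h, Matrix.vecMul_smul, Matrix.vecMul_one, sub_self]⟩
  exact le_iSup₂_of_le (f := fun k (_ : k ∈ spectrum ℂ (B.map (algebraMap ℝ ℂ))) => (‖k‖₊ : ℝ≥0∞))
    z hz le_rfl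

section Norm

attribute [local instance] Matrix.linftyOpNormedRing Matrix.linftyOpNormedAlgebra

theorem exists_spectrum_eq_specRad [Nonempty ι] (B : Matrix ι ι ℝ) :
    ∃ z : ℂ, (‖z‖₊ : ℝ≥0∞) = specRad B ∧
      (z • (1 : Matrix ι ι ℂ) - B.map (algebraMap ℝ ℂ)).det = 0 := by
  obtain ⟨z, hz, hz'⟩ := spectrum.exists_nnnorm_eq_spectralRadius_of_nonempty
    (spectrum.nonempty_of_isAlgClosed_of_finiteDimensional ℂ (B.map (algebraMap ℝ ℂ)))
  exact ⟨z, hz', (mem_spectrum_iff_det _ z).1 hz⟩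

/-- Gelfand's formula, entry by entry. -/
theorem exists_abs_pow_apply_le (B : Matrix ι ι ℝ) {s : ℝ} (hs : 0 < s)
    (hB : specRad B < ENNReal.ofReal s) :
    ∃ c : ℝ, 0 < c ∧ ∀ (k : ℕ) (i j : ι), |(B ^ k) i j| ≤ c * s ^ k := by
  set Bc := B.map (algebraMap ℝ ℂ) with hBc
  have hev : ∀ᶠ k : ℕ in atTop, ‖Bc ^ k‖ / s ^ k ≤ 1 := by
    have ht := (spectrum.pow_nnnorm_pow_one_div_tendsto_nhds_spectralRadius Bc).eventually_lt_const
      hB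
    filter_upwards [ht, eventually_gt_atTop 0] with k hk hk0
    have hk0' : (0 : ℝ) < k := by exact_mod_cast hk0
    rw [div_le_one (by positivity)]
    have h1 := ENNReal.rpow_le_rpow hk.le hk0'.le
    rw [← ENNReal.rpow_mul, one_div, inv_mul_cancel₀ hk0'.ne', ENNReal.rpow_one,
      ENNReal.rpow_natCast, ← ENNReal.ofReal_pow hs.le] at h1
    rw [← ENNReal.ofReal_le_ofReal_iff (by positivity), ofReal_norm]
    exact h1
  obtain ⟨c, hc⟩ := IsBoundedUnder.bddAbove_range (f := fun k : ℕ => ‖Bc ^ k‖ / s ^ k) ⟨1, by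
    simpa using hev⟩
  refine ⟨max c 1, by positivity, fun k i j => ?_⟩
  have h1 : ‖Bc ^ k‖ ≤ c * s ^ k := by
    have := hc ⟨k, rfl⟩
    rwa [div_le_iff₀ (by positivity)] at this
  have h2 : ‖(Bc ^ k) i j‖₊ ≤ ‖Bc ^ k‖₊ := by
    rw [Matrix.linfty_opNNNorm_def]
    exact (Finset.single_le_sum (f := fun j => ‖(Bc ^ k) i j‖₊) (fun _ _ => zero_le)
      (Finset.mem_univ j)).trans
      (Finset.le_sup (f := fun i => ∑ j, ‖(Bc ^ k) i j‖₊) (Finset.mem_univ i))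
  have h3 : (Bc ^ k) i j = (((B ^ k) i j : ℝ) : ℂ) := by
    have := congrFun (congrFun (map_pow (algebraMap ℝ ℂ).mapMatrix B k) i) j
    simpa [hBc] using this.symm
  have h4 : |(B ^ k) i j| ≤ ‖Bc ^ k‖ := by
    have h2' : ‖(Bc ^ k) i j‖ ≤ ‖Bc ^ k‖ := h2
    rwa [h3, Complex.norm_real] at h2'
  exact h4.trans (h1.trans (mul_le_mul_of_nonneg_right (le_max_left _ _) (by positivity)))

end Norm

theorem specRad_ne_top (B : Matrix ι ι ℝ) : specRad B ≠ ⊤ := by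
  cases isEmpty_or_nonempty ι
  · simp [specRad_of_isEmpty]
  · obtain ⟨z, hz, -⟩ := exists_spectrum_eq_specRad B
    rw [← hz]
    exact ENNReal.coe_ne_top

/-- The entrywise modulus of a dominant eigenvector of a nonnegative matrix is a subinvariant
vector. This is the part of Perron–Frobenius theory that the lower bound needs. -/
theorem exists_subinvariant [Nonempty ι] (B : Matrix ι ι ℝ) (hB : ∀ i j, 0 ≤ B i j) :
    ∃ x : ι → ℝ, (∀ i, 0 ≤ x i) ∧ (∃ i, 0 < x i) ∧
      ∀ i, (specRad B).toReal * x i ≤ (B *ᵥ x) i := by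
  obtain ⟨z, hz, hdet⟩ := exists_spectrum_eq_specRad B
  obtain ⟨u, hu, hu'⟩ := Matrix.exists_mulVec_eq_zero_iff.2 hdet
  rw [Matrix.sub_mulVec, Matrix.smul_mulVec, Matrix.one_mulVec, sub_eq_zero] at hu'
  obtain ⟨i, hi⟩ := Function.ne_iff.1 hu
  refine ⟨fun i => ‖u i‖, fun i => norm_nonneg _, ⟨i, norm_pos_iff.2 hi⟩, fun i => ?_⟩
  rw [← hz]
  calc ‖z‖ * ‖u i‖ = ‖(z • u) i‖ := by simp
    _ = ‖∑ j, (B i j : ℂ) * u j‖ := by rw [hu']; simp [Matrix.mulVec, dotProduct]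
    _ ≤ ∑ j, ‖(B i j : ℂ) * u j‖ := norm_sum_le _ _
    _ = (B *ᵥ fun j => ‖u j‖) i := by
      simp only [Matrix.mulVec, dotProduct, norm_mul, Complex.norm_real]
      exact Finset.sum_congr rfl fun j _ => by rw [Real.norm_of_nonneg (hB i j)]

theorem specRad_le_one_of_row_sum_le [Nonempty ι] (B : Matrix ι ι ℝ) (hB : ∀ i j, 0 ≤ B i j)
    (hsum : ∀ i, ∑ j, B i j ≤ 1) : specRad B ≤ 1 := by
  obtain ⟨x, hx0, ⟨i, hi⟩, hx⟩ := exists_subinvariant B hB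
  obtain ⟨m, hm⟩ := Finite.exists_max x
  have h1 : (specRad B).toReal * x m ≤ 1 * x m :=
    calc (specRad B).toReal * x m ≤ ∑ j, B m j * x j := hx m
      _ ≤ ∑ j, B m j * x m :=
        Finset.sum_le_sum fun j _ => mul_le_mul_of_nonneg_left (hm j) (hB m j)
      _ = (∑ j, B m j) * x m := by rw [Finset.sum_mul]
      _ ≤ 1 * x m := mul_le_mul_of_nonneg_right (hsum m) (hx0 m)
  have h2 := le_of_mul_le_mul_right h1 (hi.trans_le (hm i))
  rw [← ENNReal.ofReal_toReal (specRad_ne_top B)]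
  exact ENNReal.ofReal_le_one.2 h2

/-- If `r ρ(B) < 1`, a finite part of the Neumann series `∑ (r B)^k 1` gives a vector that `r B`
contracts strictly. -/
theorem exists_strict_superinvariant (B : Matrix ι ι ℝ) (hB : ∀ i j, 0 ≤ B i j) {r : ℝ}
    (hr : 0 < r) (hrB : ENNReal.ofReal r * specRad B < 1) :
    ∃ y : ι → ℝ, (∀ i, 1 ≤ y i) ∧ ∀ i, r * (B *ᵥ y) i + 1 ≤ y i := by
  obtain ⟨s, hs0, hs, hrs⟩ : ∃ s : ℝ, 0 < s ∧ specRad B < ENNReal.ofReal s ∧ r * s < 1 := by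
    have h1 : specRad B < ENNReal.ofReal r⁻¹ := by
      rw [ENNReal.ofReal_inv_of_pos hr, ← one_div, ENNReal.lt_div_iff_mul_lt]
      · rwa [mul_comm]
      · exact Or.inl (by simpa using hr)
      · exact Or.inl ENNReal.ofReal_ne_top
    obtain ⟨s, hs, hs'⟩ := ENNReal.lt_iff_exists_nnreal_btwn.1 h1
    have hs2 : (s : ℝ) < r⁻¹ := by
      rw [← ENNReal.ofReal_coe_nnreal] at hs'
      exact (ENNReal.ofReal_lt_ofReal_iff (by positivity)).1 hs'
    refine ⟨s, ?_, by rwa [ENNReal.ofReal_coe_nnreal], ?_⟩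
    · exact_mod_cast (zero_le.trans_lt hs : (0 : ℝ≥0∞) < s)
    · rw [mul_comm, ← lt_div_iff₀ hr, one_div]; exact hs2
  obtain ⟨c, hc, hpow⟩ := exists_abs_pow_apply_le B hs0 hs
  have hlim : Tendsto (fun k : ℕ => (Fintype.card ι * c) * (r * s) ^ k) atTop (nhds 0) := by
    simpa using (tendsto_pow_atTop_nhds_zero_of_lt_one (by positivity) hrs).const_mul
      (Fintype.card ι * c)
  obtain ⟨J, hJ, hJ1⟩ := ((hlim.eventually_le_const (by norm_num : (0 : ℝ) < 1 / 2)).and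
    (eventually_ge_atTop 1)).exists
  set C : Matrix ι ι ℝ := r • B with hC
  have hC0 : ∀ i j, 0 ≤ C i j := fun i j => mul_nonneg hr.le (hB i j)
  have hCk : ∀ k i, 0 ≤ (C ^ k *ᵥ (1 : ι → ℝ)) i := by
    intro k
    induction k with
    | zero => intro i; simp
    | succ k ih =>
      intro i
      rw [pow_succ', ← Matrix.mulVec_mulVec]
      exact Finset.sum_nonneg fun j _ => mul_nonneg (hC0 i j) (ih j)
  have hCJ : ∀ i, (C ^ J *ᵥ (1 : ι → ℝ)) i ≤ 1 / 2 := by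
    intro i
    refine le_trans ?_ hJ
    calc (C ^ J *ᵥ (1 : ι → ℝ)) i = r ^ J * ∑ j, (B ^ J) i j := by
          simp [hC, smul_pow, Matrix.mulVec, dotProduct, Finset.mul_sum]
      _ ≤ r ^ J * ∑ _j : ι, c * s ^ J := by
          gcongr with j
          exact (le_abs_self _).trans (hpow J i j)
      _ = (Fintype.card ι * c) * (r * s) ^ J := by
          simp [mul_pow]; ring
  set y : ι → ℝ := ∑ k ∈ Finset.range J, C ^ k *ᵥ (1 : ι → ℝ) with hy
  have hCy : ∀ i, (C *ᵥ y) i + 1 = y i + (C ^ J *ᵥ (1 : ι → ℝ)) i := by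
    intro i
    have h1 : C *ᵥ y = ∑ k ∈ Finset.range J, C ^ (k + 1) *ᵥ (1 : ι → ℝ) := by
      rw [hy, Matrix.mulVec_sum]
      exact Finset.sum_congr rfl fun k _ => by rw [pow_succ', Matrix.mulVec_mulVec]
    have h2 : C *ᵥ y + 1 = y + C ^ J *ᵥ (1 : ι → ℝ) := by
      rw [h1, hy, ← Finset.sum_range_succ, Finset.sum_range_succ']
      simp
    exact congrFun h2 i
  have hy1 : ∀ i, 1 ≤ y i := by
    intro i
    rw [hy, Finset.sum_apply]
    have := Finset.single_le_sum (f := fun k => (C ^ k *ᵥ (1 : ι → ℝ)) i) (fun k _ => hCk k i)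
      (Finset.mem_range.2 hJ1 : 0 ∈ Finset.range J)
    simpa using this
  refine ⟨(2 : ℝ) • y, fun i => ?_, fun i => ?_⟩
  · have := hy1 i
    simp only [Pi.smul_apply, smul_eq_mul]; linarith
  · have h1 := hCy i
    have h2 := hCJ i
    rw [hC, Matrix.smul_mulVec] at h1
    simp only [Matrix.mulVec_smul, Pi.smul_apply, smul_eq_mul] at h1 ⊢
    linarith

end Spectral

/-! ### Growth of the estimation cost -/

section QuadForm

variable {ι : Type*} [Fintype ι]

/-- For `u = a + b i`, the real quadratic form `X ↦ aᵀ X a + bᵀ X b`. It is `u* X u` when `X` is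
symmetric. -/
def quadForm (a b : ι → ℝ) (X : Matrix ι ι ℝ) : ℝ := a ⬝ᵥ X *ᵥ a + b ⬝ᵥ X *ᵥ b

theorem quadForm_add (a b : ι → ℝ) (X Y : Matrix ι ι ℝ) :
    quadForm a b (X + Y) = quadForm a b X + quadForm a b Y := by
  simp only [quadForm, Matrix.add_mulVec, dotProduct_add]; ring

theorem quadForm_nonneg (a b : ι → ℝ) {X : Matrix ι ι ℝ} (hX : X.PosSemidef) :
    0 ≤ quadForm a b X :=
  add_nonneg (hX.dotProduct_mulVec_nonneg a) (hX.dotProduct_mulVec_nonneg b)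

/-- If `(a + b i)ᵀ A = (α + γ i) (a + b i)ᵀ`, the form `quadForm a b` scales by `|α + γ i|²` under
`X ↦ A X Aᵀ`. -/
theorem quadForm_conj (a b : ι → ℝ) (A X : Matrix ι ι ℝ) (α γ : ℝ)
    (ha : a ᵥ* A = α • a - γ • b) (hb : b ᵥ* A = γ • a + α • b) :
    quadForm a b (A * X * Aᵀ) = (α ^ 2 + γ ^ 2) * quadForm a b X := by
  have key : ∀ w : ι → ℝ, w ⬝ᵥ (A * X * Aᵀ) *ᵥ w = (w ᵥ* A) ⬝ᵥ X *ᵥ (w ᵥ* A) := by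
    intro w
    rw [← Matrix.mulVec_mulVec, ← Matrix.mulVec_mulVec, Matrix.dotProduct_mulVec,
      Matrix.mulVec_transpose]
  rw [quadForm, key, key, ha, hb]
  simp only [quadForm, Matrix.mulVec_sub, Matrix.mulVec_add, Matrix.mulVec_smul, sub_dotProduct,
    add_dotProduct, dotProduct_sub, dotProduct_add, smul_dotProduct, dotProduct_smul, smul_eq_mul]
  ring

theorem dotProduct_mulVec_le_trace {X : Matrix ι ι ℝ} (hX : X.PosSemidef) (a : ι → ℝ) :
    a ⬝ᵥ X *ᵥ a ≤ (a ⬝ᵥ a) * X.trace := by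
  obtain ⟨m, y, rfl⟩ := Matrix.posSemidef_iff_eq_sum_vecMulVec.1 hX
  have h1 : a ⬝ᵥ (∑ k, Matrix.vecMulVec (y k) (star (y k))) *ᵥ a = ∑ k, (∑ i, a i * y k i) ^ 2 := by
    rw [Matrix.sum_mulVec, dotProduct_sum]
    refine Finset.sum_congr rfl fun k _ => ?_
    rw [Matrix.vecMulVec_mulVec, star_trivial, sq]
    simp [dotProduct, Finset.mul_sum, mul_comm, mul_left_comm]
  rw [h1, Matrix.trace_sum, Finset.mul_sum]
  refine Finset.sum_le_sum fun k _ => (Finset.sum_mul_sq_le_sq_mul_sq _ _ _).trans (le_of_eq ?_)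
  simp [dotProduct, sq, Matrix.trace_vecMulVec]

theorem quadForm_le_trace (a b : ι → ℝ) {X : Matrix ι ι ℝ} (hX : X.PosSemidef) :
    quadForm a b X ≤ (a ⬝ᵥ a + b ⬝ᵥ b) * X.trace := by
  rw [quadForm, add_mul]
  exact add_le_add (dotProduct_mulVec_le_trace hX a) (dotProduct_mulVec_le_trace hX b)

theorem abs_trace_conj_le (X W : Matrix ι ι ℝ) {e : ℝ} (hX : ∀ i j, |X i j| ≤ e) :
    |(X * W * Xᵀ).trace| ≤ (Fintype.card ι * ∑ j, ∑ k, |W j k|) * e ^ 2 := by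
  have h1 : (X * W * Xᵀ).trace = ∑ i, ∑ k, ∑ j, X i j * W j k * X i k := by
    simp [Matrix.trace, Matrix.mul_apply, Finset.sum_mul]
  rw [h1]
  refine (Finset.abs_sum_le_sum_abs _ _).trans ?_
  have h2 : ∀ i, |∑ k, ∑ j, X i j * W j k * X i k| ≤ (∑ j, ∑ k, |W j k|) * e ^ 2 := by
    intro i
    rw [Finset.sum_comm, Finset.sum_mul]
    refine (Finset.abs_sum_le_sum_abs _ _).trans (Finset.sum_le_sum fun j _ => ?_)
    rw [Finset.sum_mul]
    refine (Finset.abs_sum_le_sum_abs _ _).trans (Finset.sum_le_sum fun k _ => ?_)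
    have he : 0 ≤ e := (abs_nonneg _).trans (hX i j)
    rw [abs_mul, abs_mul]
    calc |X i j| * |W j k| * |X i k| = |W j k| * (|X i j| * |X i k|) := by ring
      _ ≤ |W j k| * (e * e) := by gcongr <;> exact hX _ _
      _ = |W j k| * e ^ 2 := by ring
  calc ∑ i, |∑ k, ∑ j, X i j * W j k * X i k| ≤ ∑ _i : ι, (∑ j, ∑ k, |W j k|) * e ^ 2 :=
        Finset.sum_le_sum fun i _ => h2 i
    _ = _ := by simp; ring

end QuadForm

namespace LTIProcess

variable (p : LTIProcess)

theorem theta_posSemidef {X : Matrix (Fin p.l) (Fin p.l) ℝ} (hX : X.PosSemidef) :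
    (p.theta X).PosSemidef := by
  have := hX.mul_mul_conjTranspose_same p.A
  rw [Matrix.conjTranspose_eq_transpose_of_trivial] at this
  exact this.add p.W_psd

theorem iterate_theta_posSemidef (i : ℕ) : ((p.theta)^[i] p.Pbar).PosSemidef := by
  induction i with
  | zero => exact p.Pbar_psd
  | succ i ih => rw [Function.iterate_succ_apply']; exact p.theta_posSemidef ih

theorem iterate_theta (i : ℕ) (X : Matrix (Fin p.l) (Fin p.l) ℝ) :
    (p.theta)^[i] X = p.A ^ i * X * (p.A ^ i)ᵀ +
      ∑ j ∈ Finset.range i, p.A ^ j * p.W * (p.A ^ j)ᵀ := by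
  induction i with
  | zero => simp
  | succ i ih =>
    rw [Function.iterate_succ_apply', ih, theta, Finset.sum_range_succ']
    simp only [pow_succ', Matrix.transpose_mul, Matrix.mul_add, Matrix.add_mul, Finset.mul_sum,
      Finset.sum_mul, Matrix.mul_assoc, pow_zero, Matrix.transpose_one, Matrix.mul_one,
      Matrix.one_mul, add_assoc]

theorem exists_cost_le {r : ℝ} (hr : 0 < r) (hA : specRad p.A ^ 2 < ENNReal.ofReal r) :
    ∃ c : ℝ, 0 ≤ c ∧ ∀ i, p.cost i ≤ c * (1 + r ^ i) := by
  -- a rate `s` in between, so that the geometric sum of ratio `s ^ 2` is `O(1 + r ^ i)` also if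
  -- `r = 1`
  obtain ⟨s, hs0, hs, hsr⟩ : ∃ s : ℝ, 0 < s ∧ specRad p.A < ENNReal.ofReal s ∧ s ^ 2 < r := by
    have h1 : specRad p.A < ENNReal.ofReal (√r) := by
      by_contra! h
      have h2 : ENNReal.ofReal (√r) ^ 2 ≤ specRad p.A ^ 2 := by gcongr
      rw [← ENNReal.ofReal_pow (Real.sqrt_nonneg r), Real.sq_sqrt hr.le] at h2
      exact absurd hA (not_lt.2 h2)
    obtain ⟨s, hs, hs'⟩ := ENNReal.lt_iff_exists_nnreal_btwn.1 h1
    have hs2 : (s : ℝ) < √r := by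
      rw [← ENNReal.ofReal_coe_nnreal] at hs'
      exact (ENNReal.ofReal_lt_ofReal_iff (by positivity)).1 hs'
    refine ⟨s, ?_, by rwa [ENNReal.ofReal_coe_nnreal], ?_⟩
    · exact_mod_cast (zero_le.trans_lt hs : (0 : ℝ≥0∞) < s)
    · exact (Real.lt_sqrt s.2).1 hs2
  obtain ⟨c, hc, hpow⟩ := exists_abs_pow_apply_le p.A hs0 hs
  set cP := (Fintype.card (Fin p.l) * ∑ j, ∑ k, |p.Pbar j k|) * c ^ 2 with hcP
  set cW := (Fintype.card (Fin p.l) * ∑ j, ∑ k, |p.W j k|) * c ^ 2 with hcW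
  have hcP0 : 0 ≤ cP := by positivity
  have hcW0 : 0 ≤ cW := by positivity
  obtain ⟨g, hg0, hg⟩ : ∃ g : ℝ, 0 ≤ g ∧
      ∀ i, ∑ j ∈ Finset.range i, (s ^ 2) ^ j ≤ g * (1 + r ^ i) := by
    rcases le_or_gt r 1 with h1 | h1
    · have hs1 : s ^ 2 < 1 := hsr.trans_le h1
      have hpos : 0 < 1 - s ^ 2 := by linarith
      refine ⟨(1 - s ^ 2)⁻¹, by positivity, fun i => ?_⟩
      have := Summable.sum_le_tsum (Finset.range i) (fun j _ => by positivity)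
        (summable_geometric_of_lt_one (by positivity : 0 ≤ s ^ 2) hs1)
      rw [tsum_geometric_of_lt_one (by positivity) hs1] at this
      refine this.trans (le_mul_of_one_le_right (by positivity) ?_)
      have : 0 < r ^ i := by positivity
      linarith
    · have hpos : 0 < r - 1 := by linarith
      refine ⟨(r - 1)⁻¹, by positivity, fun i => ?_⟩
      calc ∑ j ∈ Finset.range i, (s ^ 2) ^ j ≤ ∑ j ∈ Finset.range i, r ^ j :=
            Finset.sum_le_sum fun j _ => pow_le_pow_left₀ (by positivity) hsr.le j
        _ = (r - 1)⁻¹ * (r ^ i - 1) := by rw [geom_sum_eq h1.ne', div_eq_inv_mul]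
        _ ≤ _ := by gcongr; linarith
  refine ⟨cP + cW * g, by positivity, fun i => ?_⟩
  have hterm : ∀ (X : Matrix (Fin p.l) (Fin p.l) ℝ) (j : ℕ),
      (p.A ^ j * X * (p.A ^ j)ᵀ).trace ≤
        (Fintype.card (Fin p.l) * ∑ j, ∑ k, |X j k|) * c ^ 2 * (s ^ 2) ^ j := by
    intro X j
    refine (le_abs_self _).trans ((abs_trace_conj_le _ _ (hpow j)).trans (le_of_eq ?_))
    ring
  rw [cost, iterate_theta, Matrix.trace_add, Matrix.trace_sum]
  calc _ ≤ cP * (s ^ 2) ^ i + ∑ j ∈ Finset.range i, cW * (s ^ 2) ^ j :=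
        add_le_add (hterm _ _) (Finset.sum_le_sum fun j _ => hterm _ _)
    _ = cP * (s ^ 2) ^ i + cW * ∑ j ∈ Finset.range i, (s ^ 2) ^ j := by rw [Finset.mul_sum]
    _ ≤ cP * (1 + r ^ i) + cW * (g * (1 + r ^ i)) := by
        gcongr
        · have := pow_le_pow_left₀ (by positivity) hsr.le i
          linarith
        · exact hg i
    _ = _ := by ring

variable {p}

/-- `K C P⁻` is the reduction of the error covariance by a measurement: a direction in which the
covariance is not reduced annihilates the gain. -/
theorem vecMul_gain_eq_zero (a : Fin p.l → ℝ) (hS : p.innovCov.PosSemidef)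
    (ha : a ⬝ᵥ (p.gain * p.C * p.theta p.Pbar) *ᵥ a = 0) : a ᵥ* p.gain = 0 := by
  have hQ : (p.theta p.Pbar)ᵀ = p.theta p.Pbar := by
    have := (p.theta_posSemidef p.Pbar_psd).1
    rwa [Matrix.IsHermitian, Matrix.conjTranspose_eq_transpose_of_trivial] at this
  have hSi := hS.inv
  have hSt : (p.innovCov⁻¹)ᵀ = p.innovCov⁻¹ := by
    have := hSi.1
    rwa [Matrix.IsHermitian, Matrix.conjTranspose_eq_transpose_of_trivial] at this
  set y := p.C *ᵥ (p.theta p.Pbar *ᵥ a) with hy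
  have hy' : a ᵥ* (p.theta p.Pbar * p.Cᵀ) = y := by
    rw [hy, ← Matrix.vecMul_vecMul, Matrix.vecMul_transpose]
    congr 1
    conv_lhs => rw [← hQ]
    rw [Matrix.vecMul_transpose]
  have h1 : star y ⬝ᵥ p.innovCov⁻¹ *ᵥ y = 0 := by
    rw [star_trivial, ← ha, gain, ← Matrix.mulVec_mulVec, ← Matrix.mulVec_mulVec, ← hy,
      ← Matrix.mulVec_mulVec, Matrix.dotProduct_mulVec a, hy']
  have h2 := (hSi.dotProduct_mulVec_zero_iff y).1 h1
  rw [gain, ← Matrix.vecMul_vecMul, hy', ← hSt, Matrix.vecMul_transpose, h2]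

/-- Stability of the local filter rules out that an unstable mode of `A` is neither excited by the
process noise nor present in the error covariance, so that the cost grows at the rate of the
mode. On the unit circle the mode has to be excited by the noise, which gives linear growth. -/
theorem exists_le_cost (hp : p.StableSteadyKalman) (hA : 1 ≤ specRad p.A) :
    ∃ c : ℝ, 0 < c ∧ ∀ i,
      c * ∑ j ∈ Finset.range i, ((specRad p.A).toReal ^ 2) ^ j ≤ p.cost i := by
  have hne : Nonempty (Fin p.l) := by
    by_contra h
    rw [not_nonempty_iff] at h
    rw [specRad_of_isEmpty] at hA
    exact absurd hA (by simp)
  obtain ⟨z, hz, hdet⟩ := exists_spectrum_eq_specRad p.A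
  obtain ⟨u, hu, hu'⟩ := Matrix.exists_vecMul_eq_zero_iff.2 hdet
  rw [Matrix.vecMul_sub, Matrix.vecMul_smul, Matrix.vecMul_one, sub_eq_zero] at hu'
  set ρ := (specRad p.A).toReal with hρ
  have hρz : ρ = ‖z‖ := by rw [hρ, ← hz]; rfl
  have hρ1 : 1 ≤ ρ := by
    rw [hρ, ← ENNReal.toReal_one]
    exact ENNReal.toReal_mono (specRad_ne_top _) hA
  set a : Fin p.l → ℝ := fun i => (u i).re with ha
  set b : Fin p.l → ℝ := fun i => (u i).im with hb
  have hentry : ∀ j, ∑ i, u i * (p.A i j : ℂ) = z * u j := by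
    intro j
    have := congrFun hu' j
    simpa [Matrix.vecMul, dotProduct] using this.symm
  have haA : a ᵥ* p.A = z.re • a - z.im • b := by
    ext j
    have := congrArg Complex.re (hentry j)
    simpa [Matrix.vecMul, dotProduct, ha, hb] using this
  have hbA : b ᵥ* p.A = z.im • a + z.re • b := by
    ext j
    have := congrArg Complex.im (hentry j)
    simp [Matrix.vecMul, dotProduct, ha, hb] at this ⊢
    linarith
  have hzsq : z.re ^ 2 + z.im ^ 2 = ρ ^ 2 := by
    rw [hρz, ← Complex.normSq_eq_norm_sq, Complex.normSq_apply]; ring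
  set q := quadForm a b with hq
  have hqθ : ∀ X, q (p.theta X) = ρ ^ 2 * q X + q p.W := by
    intro X
    rw [theta, hq, quadForm_add, quadForm_conj a b p.A X z.re z.im haA hbA, hzsq]
  have hqW := quadForm_nonneg a b p.W_psd
  have hqP := quadForm_nonneg a b p.Pbar_psd
  have hqi : ∀ i, q ((p.theta)^[i] p.Pbar) =
      (ρ ^ 2) ^ i * q p.Pbar + q p.W * ∑ j ∈ Finset.range i, (ρ ^ 2) ^ j := by
    intro i
    induction i with
    | zero => simp
    | succ i ih =>
      rw [Function.iterate_succ_apply', hqθ, ih, Finset.sum_range_succ', pow_succ']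
      simp only [pow_succ', ← Finset.mul_sum, pow_zero]
      ring
  -- otherwise `uᵀ K = 0`, and the mode persists in the error dynamics `(I - K C) A`
  have hexc : 0 < q p.W ∨ (1 < ρ ∧ 0 < q p.Pbar) := by
    by_contra! hcon
    have hW0 : q p.W = 0 := le_antisymm hcon.1 hqW
    have hQP : q (p.theta p.Pbar) = q p.Pbar := by
      rw [hqθ, hW0, add_zero]
      rcases hρ1.eq_or_lt with h1 | h1
      · rw [← h1]; ring
      · rw [le_antisymm (hcon.2 h1) hqP, mul_zero]
    have hS : p.innovCov.PosSemidef := by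
      have := (p.theta_posSemidef p.Pbar_psd).mul_mul_conjTranspose_same p.C
      rw [Matrix.conjTranspose_eq_transpose_of_trivial] at this
      exact this.add p.Z_psd
    have hsplit : p.theta p.Pbar = p.Pbar + p.gain * p.C * p.theta p.Pbar := by
      have := hp.fixed
      rw [Matrix.sub_mul, Matrix.one_mul] at this
      rw [eq_sub_iff_add_eq] at this
      exact this.symm
    have h0 : q (p.gain * p.C * p.theta p.Pbar) = 0 := by
      have h1 := congrArg q hsplit
      rw [hq, quadForm_add, ← hq, hQP] at h1
      linarith
    have hpsd : ∀ w : Fin p.l → ℝ, 0 ≤ w ⬝ᵥ (p.gain * p.C * p.theta p.Pbar) *ᵥ w := by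
      have hQ : (p.theta p.Pbar)ᵀ = p.theta p.Pbar := by
        have := (p.theta_posSemidef p.Pbar_psd).1
        rwa [Matrix.IsHermitian, Matrix.conjTranspose_eq_transpose_of_trivial] at this
      have h1 := hS.inv.mul_mul_conjTranspose_same (p.theta p.Pbar * p.Cᵀ)
      rw [Matrix.conjTranspose_eq_transpose_of_trivial, Matrix.transpose_mul,
        Matrix.transpose_transpose, hQ] at h1
      intro w
      have h2 := h1.dotProduct_mulVec_nonneg w
      rw [star_trivial] at h2
      simpa only [gain, Matrix.mul_assoc] using h2
    have ha0 := vecMul_gain_eq_zero a hS (by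
      have h1 := hpsd a; have h2 := hpsd b
      rw [hq, quadForm] at h0; linarith)
    have hb0 := vecMul_gain_eq_zero b hS (by
      have h1 := hpsd a; have h2 := hpsd b
      rw [hq, quadForm] at h0; linarith)
    have hE : ∀ w : Fin p.l → ℝ, w ᵥ* p.gain = 0 →
        w ᵥ* ((1 - p.gain * p.C) * p.A) = w ᵥ* p.A := by
      intro w hw
      rw [← Matrix.vecMul_vecMul, Matrix.vecMul_sub, Matrix.vecMul_one, ← Matrix.vecMul_vecMul, hw,
        Matrix.zero_vecMul, sub_zero]
    have heig : u ᵥ* ((1 - p.gain * p.C) * p.A).map (algebraMap ℝ ℂ) = z • u := by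
      ext j
      have h1 := congrFun ((hE a ha0).trans haA) j
      have h2 := congrFun ((hE b hb0).trans hbA) j
      simp only [Matrix.vecMul, dotProduct, ha, hb, Pi.sub_apply, Pi.add_apply, Pi.smul_apply,
        smul_eq_mul] at h1 h2
      apply Complex.ext
      · simpa [Matrix.vecMul, dotProduct] using h1
      · simp only [Matrix.vecMul, dotProduct, Matrix.map_apply, Complex.coe_algebraMap,
          Complex.im_sum, Pi.smul_apply, smul_eq_mul, Complex.mul_im, Complex.ofReal_re,
          Complex.ofReal_im, mul_zero, zero_add]
        linarith
    have h3 := nnnorm_le_specRad_of_vecMul _ z u hu heig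
    rw [hz] at h3
    exact absurd (hA.trans h3) (not_le.2 hp.stable)
  obtain ⟨c, hc, hcq⟩ : ∃ c : ℝ, 0 < c ∧
      ∀ i, c * ∑ j ∈ Finset.range i, (ρ ^ 2) ^ j ≤ q ((p.theta)^[i] p.Pbar) := by
    rcases hexc with h1 | ⟨h1, h2⟩
    · refine ⟨q p.W, h1, fun i => ?_⟩
      rw [hqi]
      have : 0 ≤ (ρ ^ 2) ^ i * q p.Pbar := mul_nonneg (by positivity) hqP
      linarith
    · have h3 : 0 < ρ ^ 2 - 1 := by nlinarith
      refine ⟨(ρ ^ 2 - 1) * q p.Pbar, by positivity, fun i => ?_⟩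
      rw [hqi]
      have h4 : (∑ j ∈ Finset.range i, (ρ ^ 2) ^ j) * (ρ ^ 2 - 1) = (ρ ^ 2) ^ i - 1 :=
        geom_sum_mul _ _
      have h5 : 0 ≤ q p.W * ∑ j ∈ Finset.range i, (ρ ^ 2) ^ j := mul_nonneg hqW (by positivity)
      nlinarith
  have hab : 0 < a ⬝ᵥ a + b ⬝ᵥ b := by
    obtain ⟨i, hi⟩ := Function.ne_iff.1 hu
    have h1 : a ⬝ᵥ a + b ⬝ᵥ b = ∑ i, Complex.normSq (u i) := by
      simp [dotProduct, ← Finset.sum_add_distrib, Complex.normSq_apply, ha, hb]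
    rw [h1]
    exact Finset.sum_pos' (fun i _ => Complex.normSq_nonneg _)
      ⟨i, Finset.mem_univ i, Complex.normSq_pos.2 hi⟩
  refine ⟨c / (a ⬝ᵥ a + b ⬝ᵥ b), by positivity, fun i => ?_⟩
  rw [div_mul_eq_mul_div, div_le_iff₀ hab, mul_comm (p.cost i)]
  exact (hcq i).trans (quadForm_le_trace a b (p.iterate_theta_posSemidef i))

end LTIProcess

/-! ### One step of the channel and of the ages of information -/

theorem lintegral_comp_fintype {Ω Z : Type*} [MeasurableSpace Ω] {P : Measure Ω}
    [MeasurableSpace Z] [Fintype Z] [MeasurableSingletonClass Z] {G : Ω → Z} (hG : Measurable G)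
    (f : Z → ℝ≥0∞) : ∫⁻ ω, f (G ω) ∂P = ∑ z, f z * P (G ⁻¹' {z}) := by
  rw [← lintegral_map (measurable_of_finite f) hG, lintegral_fintype]
  exact Finset.sum_congr rfl fun z _ => by
    rw [Measure.map_apply hG (measurableSet_singleton z)]

namespace SemiMarkovChannel

variable {M : ℕ} {L : Fin M → ℕ} {D : ℕ} (ch : SemiMarkovChannel M L D)

theorem hazard_nonneg (i : QState L) (k : Fin D) : 0 ≤ ch.hazard i k :=
  div_nonneg (ch.hold_nonneg i k) (Finset.sum_nonneg fun _ _ => ch.hold_nonneg i _)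

theorem hazard_le_one (i : QState L) (k : Fin D) : ch.hazard i k ≤ 1 :=
  div_le_one_of_le₀
    (Finset.single_le_sum (f := ch.hold i) (fun _ _ => ch.hold_nonneg i _)
      (Finset.mem_Ici.2 le_rfl))
    (Finset.sum_nonneg fun _ _ => ch.hold_nonneg i _)

theorem augMatrix_nonneg (i j : ChState L D) : 0 ≤ ch.augMatrix i j := by
  unfold augMatrix
  split_ifs
  · exact mul_nonneg (ch.trans_nonneg _ _) (ch.hazard_nonneg _ _)
  · exact sub_nonneg.2 (ch.hazard_le_one _ _)
  · exact le_rfl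

theorem augMatrix_row_sum_le (i : ChState L D) : ∑ j, ch.augMatrix i j ≤ 1 := by
  have h1 : ∀ j, ch.augMatrix i j ≤
      (if (j.2 : ℕ) = 0 then ch.trans i.1 j.1 * ch.hazard i.1 i.2 else 0) +
        if (j.2 : ℕ) = (i.2 : ℕ) + 1 ∧ j.1 = i.1 then 1 - ch.hazard i.1 i.2 else 0 := by
    intro j
    have := sub_nonneg.2 (ch.hazard_le_one i.1 i.2)
    unfold augMatrix
    split_ifs <;> simp_all
  have hsub : ∀ (c : ℕ) (a : ℝ), 0 ≤ a → ∑ k : Fin D, (if (k : ℕ) = c then a else 0) ≤ a := by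
    intro c a ha
    rw [← Finset.sum_filter, Finset.sum_const, nsmul_eq_mul]
    refine mul_le_of_le_one_left ha ?_
    have : (Finset.univ.filter fun k : Fin D => (k : ℕ) = c).card ≤ 1 := by
      rw [Finset.card_le_one]
      intro x hx y hy
      simp only [Finset.mem_filter, Finset.mem_univ, true_and] at hx hy
      exact Fin.ext (hx.trans hy.symm)
    exact_mod_cast this
  refine (Finset.sum_le_sum fun j _ => h1 j).trans ?_
  rw [Finset.sum_add_distrib, Fintype.sum_prod_type, Fintype.sum_prod_type]
  have h2 : ∑ q : QState L, ∑ k : Fin D,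
      (if (k : ℕ) = 0 then ch.trans i.1 q * ch.hazard i.1 i.2 else 0) ≤ ch.hazard i.1 i.2 := by
    calc _ ≤ ∑ q : QState L, ch.trans i.1 q * ch.hazard i.1 i.2 :=
          Finset.sum_le_sum fun q _ =>
            hsub 0 _ (mul_nonneg (ch.trans_nonneg _ _) (ch.hazard_nonneg _ _))
      _ = _ := by rw [← Finset.sum_mul, ch.trans_sum, one_mul]
  have h3 : ∑ q : QState L, ∑ k : Fin D,
      (if (k : ℕ) = (i.2 : ℕ) + 1 ∧ q = i.1 then 1 - ch.hazard i.1 i.2 else 0) ≤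
        1 - ch.hazard i.1 i.2 := by
    rw [Finset.sum_eq_single i.1]
    · simpa using hsub ((i.2 : ℕ) + 1) _ (sub_nonneg.2 (ch.hazard_le_one i.1 i.2))
    · intro q _ hq
      simp [hq]
    · simp
  linarith

theorem drop_nonneg (i : ChState L D) (m : Fin M) : 0 ≤ ch.drop i m :=
  Finset.sum_nonneg fun o _ => by
    split_ifs
    exacts [ch.outcome_nonneg i o, le_rfl]

theorem drop_le_one (i : ChState L D) (m : Fin M) : ch.drop i m ≤ 1 := by
  rw [← ch.outcome_sum i]
  refine Finset.sum_le_sum fun o _ => ?_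
  split_ifs
  exacts [le_rfl, ch.outcome_nonneg i o]

theorem dropMatrix_mul_apply (v : ChState L D → Fin M) (i j : ChState L D) :
    (ch.dropMatrix v * ch.augMatrix) i j = ch.drop i (v i) * ch.augMatrix i j := by
  simp [dropMatrix, Matrix.diagonal_mul]

theorem dropMatrix_mul_nonneg (v : ChState L D → Fin M) (i j : ChState L D) :
    0 ≤ (ch.dropMatrix v * ch.augMatrix) i j := by
  rw [dropMatrix_mul_apply]
  exact mul_nonneg (ch.drop_nonneg _ _) (ch.augMatrix_nonneg _ _)

theorem dropMatrix_mul_mulVec (v : ChState L D → Fin M) (x : ChState L D → ℝ) (i : ChState L D) :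
    ((ch.dropMatrix v * ch.augMatrix) *ᵥ x) i = ch.drop i (v i) * (ch.augMatrix *ᵥ x) i := by
  rw [← Matrix.mulVec_mulVec, dropMatrix, Matrix.mulVec_diagonal]

theorem specRad_dropMatrix_mul_le_one [Nonempty (ChState L D)] (v : ChState L D → Fin M) :
    specRad (ch.dropMatrix v * ch.augMatrix) ≤ 1 := by
  refine specRad_le_one_of_row_sum_le _ (ch.dropMatrix_mul_nonneg v) fun i => ?_
  refine le_trans (Finset.sum_le_sum fun j _ => ?_) (ch.augMatrix_row_sum_le i)
  rw [dropMatrix_mul_apply]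
  exact mul_le_of_le_one_left (ch.augMatrix_nonneg i j) (ch.drop_le_one _ _)

variable {ch}
variable {Ω : Type*} [MeasurableSpace Ω] {P : Measure Ω} {h : ℕ → Ω → ChState L D}
  {μ : ℕ → Ω → Fin M → Bool}

namespace IsRealization

/-- The path law, with the outcome of the last slot summed out. -/
theorem law_before_outcome (hreal : ch.IsRealization P h μ) (T : ℕ) (x : ℕ → ChState L D)
    (o : ℕ → Fin M → Bool) :
    P {ω | (∀ t < T, h t ω = x t ∧ μ t ω = o t) ∧ h T ω = x T} =
      P {ω | h 0 ω = x 0} * ENNReal.ofReal ((∏ t ∈ Finset.range T, ch.augMatrix (x t) (x (t + 1))) *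
          ∏ t ∈ Finset.range T, ch.outcome (x t) (o t)) := by
  set A := {ω | (∀ t < T, h t ω = x t ∧ μ t ω = o t) ∧ h T ω = x T} with hA
  have h1 : P A = ∑ o' : Fin M → Bool, P (μ T ⁻¹' {o'} ∩ A) := by
    have := sum_measure_preimage_singleton (μ := P.restrict A) (f := μ T)
      (Finset.univ : Finset (Fin M → Bool))
      (fun o' _ => hreal.measurable_outcome T (measurableSet_singleton o'))
    rw [Finset.coe_univ, Set.preimage_univ, Measure.restrict_apply_univ] at this
    rw [← this]
    exact Finset.sum_congr rfl fun o' _ =>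
      Measure.restrict_apply (hreal.measurable_outcome T (measurableSet_singleton o'))
  have h2 : ∀ o' : Fin M → Bool, P (μ T ⁻¹' {o'} ∩ A) = P {ω | h 0 ω = x 0} *
      ENNReal.ofReal (((∏ t ∈ Finset.range T, ch.augMatrix (x t) (x (t + 1))) *
        ∏ t ∈ Finset.range T, ch.outcome (x t) (o t)) * ch.outcome (x T) o') := by
    intro o'
    have h3 : μ T ⁻¹' {o'} ∩ A =
        {ω | ∀ t ≤ T, h t ω = x t ∧ μ t ω = Function.update o T o' t} := by
      ext ω
      simp only [hA, Set.mem_inter_iff, Set.mem_preimage, Set.mem_singleton_iff, Set.mem_ofPred_eq]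
      constructor
      · rintro ⟨h4, h5, h6⟩ t ht
        rcases ht.lt_or_eq with h7 | rfl
        · rw [Function.update_of_ne h7.ne]; exact h5 t h7
        · rw [Function.update_self]; exact ⟨h6, h4⟩
      · intro h4
        have h5 := h4 T le_rfl
        rw [Function.update_self] at h5
        refine ⟨h5.2, fun t ht => ?_, h5.1⟩
        have := h4 t ht.le
        rwa [Function.update_of_ne ht.ne] at this
    rw [h3, hreal.law, Finset.prod_range_succ, Function.update_self, mul_assoc]
    congr 4
    exact Finset.prod_congr rfl fun t ht => by
      rw [Function.update_of_ne (Finset.mem_range.1 ht).ne]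
  have h0 : 0 ≤ (∏ t ∈ Finset.range T, ch.augMatrix (x t) (x (t + 1))) *
        ∏ t ∈ Finset.range T, ch.outcome (x t) (o t) :=
    mul_nonneg (Finset.prod_nonneg fun _ _ => ch.augMatrix_nonneg _ _)
      (Finset.prod_nonneg fun _ _ => ch.outcome_nonneg _ _)
  rw [h1, Finset.sum_congr rfl fun o' _ => h2 o', ← Finset.mul_sum,
    ← ENNReal.ofReal_sum_of_nonneg fun o' _ => mul_nonneg h0 (ch.outcome_nonneg _ _),
    ← Finset.mul_sum, ch.outcome_sum, mul_one]

theorem law_succ (hreal : ch.IsRealization P h μ) (T : ℕ) (x : ℕ → ChState L D)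
    (o : ℕ → Fin M → Bool) :
    P {ω | (∀ t < T + 1, h t ω = x t ∧ μ t ω = o t) ∧ h (T + 1) ω = x (T + 1)} =
      P {ω | (∀ t < T, h t ω = x t ∧ μ t ω = o t) ∧ h T ω = x T} *
        ENNReal.ofReal (ch.outcome (x T) (o T) * ch.augMatrix (x T) (x (T + 1))) := by
  rw [hreal.law_before_outcome, hreal.law_before_outcome, Finset.prod_range_succ,
    Finset.prod_range_succ, mul_assoc (P _), ← ENNReal.ofReal_mul]
  · congr 2
    ring
  · exact mul_nonneg (Finset.prod_nonneg fun _ _ => ch.augMatrix_nonneg _ _)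
      (Finset.prod_nonneg fun _ _ => ch.outcome_nonneg _ _)

/-- Given the past and the current channel state, the outcomes and the next channel state are
independent, distributed according to `ch.outcome` and `ch.augMatrix`. The random variable `X`
depends on the strict past only, as the ages of information do. -/
theorem lintegral_step (hreal : ch.IsRealization P h μ) {α : Type*} (T : ℕ) (X : Ω → α)
    (hX : ∀ ω ω', (∀ t < T, h t ω = h t ω' ∧ μ t ω = μ t ω') → X ω = X ω')
    (F : α → ChState L D → (Fin M → Bool) → ChState L D → ℝ≥0∞) :
    ∫⁻ ω, F (X ω) (h T ω) (μ T ω) (h (T + 1) ω) ∂P =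
      ∫⁻ ω, ∑ o, ∑ y, ENNReal.ofReal (ch.outcome (h T ω) o * ch.augMatrix (h T ω) y) *
        F (X ω) (h T ω) o y ∂P := by
  rcases isEmpty_or_nonempty Ω with hΩ | ⟨⟨ω₀⟩⟩
  · simp [lintegral_of_isEmpty]
  have : Nonempty α := ⟨X ω₀⟩
  set past : Ω → Fin T → ChState L D × (Fin M → Bool) := fun ω t => (h t ω, μ t ω) with hpast
  have hpm : Measurable past := measurable_pi_lambda _ fun t =>
    (hreal.measurable_state t).prodMk (hreal.measurable_outcome t)
  obtain ⟨X', rfl⟩ : ∃ X', X = X' ∘ past := by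
    refine (Function.factorsThrough_iff X).1 fun ω ω' hω => hX ω ω' fun t ht => ?_
    exact Prod.mk.inj (congrFun hω ⟨t, ht⟩)
  set G₁ : Ω → (Fin T → ChState L D × (Fin M → Bool)) × ChState L D :=
    fun ω => (past ω, h T ω) with hG₁
  have hG₁m : Measurable G₁ := hpm.prodMk (hreal.measurable_state T)
  set G₂ : Ω → ((Fin T → ChState L D × (Fin M → Bool)) × ChState L D) ×
      ((Fin M → Bool) × ChState L D) := fun ω => (G₁ ω, μ T ω, h (T + 1) ω) with hG₂
  have hG₂m : Measurable G₂ :=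
    hG₁m.prodMk ((hreal.measurable_outcome T).prodMk (hreal.measurable_state (T + 1)))
  have hatom : ∀ p x o y, P (G₂ ⁻¹' {((p, x), (o, y))}) =
      P (G₁ ⁻¹' {(p, x)}) * ENNReal.ofReal (ch.outcome x o * ch.augMatrix x y) := by
    intro p x o y
    have key := hreal.law_succ T
      (fun t => if ht : t < T then (p ⟨t, ht⟩).1 else if t = T then x else y)
      (fun t => if ht : t < T then (p ⟨t, ht⟩).2 else o)
    simp only [lt_irrefl, dite_false, if_true, not_lt.2 (Nat.le_succ T),
      (Nat.succ_ne_self T), if_false] at key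
    have e1 : G₁ ⁻¹' {(p, x)} = {ω | (∀ t < T,
        h t ω = (if ht : t < T then (p ⟨t, ht⟩).1 else if t = T then x else y) ∧
        μ t ω = (if ht : t < T then (p ⟨t, ht⟩).2 else o)) ∧ h T ω = x} := by
      ext ω
      simp only [hG₁, hpast, Set.mem_preimage, Set.mem_singleton_iff, Prod.mk.injEq,
        Set.mem_ofPred_eq]
      refine and_congr_left fun _ => ⟨fun H t ht => ?_, fun H => funext fun t => ?_⟩
      · rw [dif_pos ht, dif_pos ht]
        exact ⟨congrArg Prod.fst (congrFun H ⟨t, ht⟩), congrArg Prod.snd (congrFun H ⟨t, ht⟩)⟩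
      · have := H t t.2
        rw [dif_pos t.2, dif_pos t.2] at this
        exact Prod.ext this.1 this.2
    have e2 : G₂ ⁻¹' {((p, x), (o, y))} = {ω | (∀ t < T + 1,
        h t ω = (if ht : t < T then (p ⟨t, ht⟩).1 else if t = T then x else y) ∧
        μ t ω = (if ht : t < T then (p ⟨t, ht⟩).2 else o)) ∧ h (T + 1) ω = y} := by
      have e3 : G₂ ⁻¹' {((p, x), (o, y))} =
          G₁ ⁻¹' {(p, x)} ∩ {ω | μ T ω = o ∧ h (T + 1) ω = y} := by
        ext ω
        simp [hG₂, Prod.ext_iff]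
      rw [e3, e1]
      ext ω
      simp only [Set.mem_inter_iff, Set.mem_ofPred_eq, Nat.forall_lt_succ_right, lt_irrefl,
        dite_false, if_true]
      tauto
    rw [e1, e2]
    exact key
  calc ∫⁻ ω, F ((X' ∘ past) ω) (h T ω) (μ T ω) (h (T + 1) ω) ∂P
      = ∫⁻ ω, (fun z : ((Fin T → ChState L D × (Fin M → Bool)) × ChState L D) ×
          ((Fin M → Bool) × ChState L D) => F (X' z.1.1) z.1.2 z.2.1 z.2.2) (G₂ ω) ∂P := rfl
    _ = ∑ z : ((Fin T → ChState L D × (Fin M → Bool)) × ChState L D) ×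
          ((Fin M → Bool) × ChState L D), F (X' z.1.1) z.1.2 z.2.1 z.2.2 * P (G₂ ⁻¹' {z}) := by
        exact lintegral_comp_fintype (P := P) hG₂m
          fun z => F (X' z.1.1) z.1.2 z.2.1 z.2.2
    _ = ∑ z : (Fin T → ChState L D × (Fin M → Bool)) × ChState L D,
          (∑ o, ∑ y, ENNReal.ofReal (ch.outcome z.2 o * ch.augMatrix z.2 y) * F (X' z.1) z.2 o y) *
            P (G₁ ⁻¹' {z}) := by
        rw [Fintype.sum_prod_type]
        refine Finset.sum_congr rfl fun z _ => ?_
        rw [Fintype.sum_prod_type, Finset.sum_mul]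
        refine Finset.sum_congr rfl fun o _ => ?_
        rw [Finset.sum_mul]
        refine Finset.sum_congr rfl fun y _ => ?_
        obtain ⟨p, x⟩ := z
        rw [hatom]
        ring
    _ = ∫⁻ ω, (fun z : (Fin T → ChState L D × (Fin M → Bool)) × ChState L D =>
          ∑ o, ∑ y, ENNReal.ofReal (ch.outcome z.2 o * ch.augMatrix z.2 y) *
            F (X' z.1) z.2 o y) (G₁ ω) ∂P := by
        exact (lintegral_comp_fintype (P := P) hG₁m fun z =>
          ∑ o, ∑ y, ENNReal.ofReal (ch.outcome z.2 o * ch.augMatrix z.2 y) *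
            F (X' z.1) z.2 o y).symm
    _ = _ := rfl

theorem lintegral_augMatrix_mulVec (hreal : ch.IsRealization P h μ) (t : ℕ)
    {g : ChState L D → ℝ} (hg : ∀ i, 0 ≤ g i) :
    ∫⁻ ω, ENNReal.ofReal (g (h (t + 1) ω)) ∂P =
      ∫⁻ ω, ENNReal.ofReal ((ch.augMatrix *ᵥ g) (h t ω)) ∂P := by
  rw [hreal.lintegral_step t (fun _ => ()) (fun _ _ _ => rfl)
    (fun _ _ _ y => ENNReal.ofReal (g y))]
  refine lintegral_congr fun ω => ?_
  have h0 : ∀ o y, 0 ≤ ch.outcome (h t ω) o * ch.augMatrix (h t ω) y := fun o y =>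
    mul_nonneg (ch.outcome_nonneg _ _) (ch.augMatrix_nonneg _ _)
  simp_rw [← ENNReal.ofReal_mul (h0 _ _)]
  rw [Finset.sum_congr rfl fun o _ => (ENNReal.ofReal_sum_of_nonneg fun y _ =>
    mul_nonneg (h0 o y) (hg y)).symm, ← ENNReal.ofReal_sum_of_nonneg fun o _ =>
    Finset.sum_nonneg fun y _ => mul_nonneg (h0 o y) (hg y)]
  congr 1
  simp_rw [mul_assoc, ← Finset.mul_sum]
  rw [← Finset.sum_mul, ch.outcome_sum, one_mul]
  rfl

theorem lintegral_augMatrix_pow_mulVec (hreal : ch.IsRealization P h μ) (k t : ℕ)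
    {g : ChState L D → ℝ} (hg : ∀ i, 0 ≤ g i) :
    ∫⁻ ω, ENNReal.ofReal (g (h (t + k) ω)) ∂P =
      ∫⁻ ω, ENNReal.ofReal ((ch.augMatrix ^ k *ᵥ g) (h t ω)) ∂P := by
  induction k generalizing g with
  | zero => simp
  | succ k ih =>
    rw [← add_assoc, hreal.lintegral_augMatrix_mulVec _ hg, ih, Matrix.mulVec_mulVec, pow_succ]
    exact fun i => Finset.sum_nonneg fun j _ => mul_nonneg (ch.augMatrix_nonneg _ _) (hg j)

/-- Irreducibility makes the expected number of visits to every state infinite. -/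
theorem tendsto_sum_lintegral (hreal : ch.IsRealization P h μ) [IsProbabilityMeasure P]
    (hirr : ch.augMatrix.IsIrreducible) {g : ChState L D → ℝ} (hg : ∀ i, 0 ≤ g i)
    (hg' : ∃ i, 0 < g i) :
    Tendsto (fun t => ∑ s ∈ Finset.range t, ∫⁻ ω, ENNReal.ofReal (g (h s ω)) ∂P) atTop
      (nhds ⊤) := by
  obtain ⟨j, hj⟩ := hg'
  have : Nonempty (ChState L D) := ⟨j⟩
  choose k _ hk using fun i =>
    (Matrix.isIrreducible_iff_exists_pow_pos hirr.nonneg).1 hirr i j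
  have hpow : ∀ k i, 0 ≤ (ch.augMatrix ^ k *ᵥ g) i := fun k i =>
    Finset.sum_nonneg fun j _ => mul_nonneg (Matrix.pow_apply_nonneg hirr.nonneg k i j) (hg j)
  obtain ⟨m, hm⟩ : ∃ m, ∀ i, k i < m := by
    obtain ⟨i₀, h₀⟩ := Finite.exists_max k
    exact ⟨k i₀ + 1, fun i => Nat.lt_succ_of_le (h₀ i)⟩
  obtain ⟨e, he, hle⟩ : ∃ e : ℝ, 0 < e ∧
      ∀ i, e ≤ ∑ l ∈ Finset.range m, (ch.augMatrix ^ l *ᵥ g) i := by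
    obtain ⟨i₀, h₀⟩ := Finite.exists_min fun i => ∑ l ∈ Finset.range m, (ch.augMatrix ^ l *ᵥ g) i
    refine ⟨_, ?_, h₀⟩
    refine Finset.sum_pos' (fun l _ => hpow l i₀) ⟨k i₀, Finset.mem_range.2 (hm i₀), ?_⟩
    exact Finset.sum_pos'
      (fun j _ => mul_nonneg (Matrix.pow_apply_nonneg hirr.nonneg _ i₀ j) (hg j))
      ⟨j, Finset.mem_univ j, mul_pos (hk i₀) hj⟩
  have hblock : ∀ t, ENNReal.ofReal e ≤
      ∑ l ∈ Finset.range m, ∫⁻ ω, ENNReal.ofReal (g (h (t + l) ω)) ∂P := by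
    intro t
    simp_rw [fun l => hreal.lintegral_augMatrix_pow_mulVec l t hg]
    rw [← lintegral_finsetSum]
    · calc ENNReal.ofReal e = ∫⁻ _ω, ENNReal.ofReal e ∂P := by simp
        _ ≤ _ := lintegral_mono fun ω => by
          rw [← ENNReal.ofReal_sum_of_nonneg fun l _ => hpow l _]
          exact ENNReal.ofReal_le_ofReal (hle _)
    · intro l _
      exact (Measurable.of_discrete (f := fun i =>
        ENNReal.ofReal ((ch.augMatrix ^ l *ᵥ g) i))).comp (hreal.measurable_state t)
  have hblocks : ∀ n : ℕ, n * ENNReal.ofReal e ≤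
      ∑ s ∈ Finset.range (n * m), ∫⁻ ω, ENNReal.ofReal (g (h s ω)) ∂P := by
    intro n
    induction n with
    | zero => simp
    | succ n ih =>
      rw [Nat.succ_mul, Finset.sum_range_add, Nat.cast_succ, add_mul, one_mul]
      exact add_le_add ih (hblock _)
  rw [ENNReal.tendsto_nhds_top_iff_nat]
  intro n
  obtain ⟨n', hn'⟩ := ENNReal.exists_nat_mul_gt (a := ENNReal.ofReal e) (b := n)
    (by simpa using he) (ENNReal.natCast_ne_top n)
  filter_upwards [eventually_ge_atTop (n' * m)] with t ht
  exact hn'.trans_le ((hblocks n').trans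
    (Finset.sum_le_sum_of_subset (Finset.range_subset_range.2 ht)))

end IsRealization

end SemiMarkovChannel

section Ages

variable {N M : ℕ} {L : Fin M → ℕ} {D : ℕ} {Ω : Type*}

/-- The ages after one slot with channel state `i` and transmission outcomes `o`. -/
def nextAge (π : Policy N M L D) (φ : Fin N → ℕ) (i : ChState L D) (o : Fin M → Bool)
    (n : Fin N) : ℕ :=
  if received (π.act φ i n) o = true then 1 else φ n + 1

theorem aoi_succ (π : Policy N M L D) (h : ℕ → Ω → ChState L D) (μ : ℕ → Ω → Fin M → Bool)
    (φ₀ : Fin N → ℕ) (t : ℕ) (ω : Ω) :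
    aoi π h μ φ₀ (t + 1) ω = nextAge π (aoi π h μ φ₀ t ω) (h t ω) (μ t ω) := rfl

theorem one_le_aoi (π : Policy N M L D) (h : ℕ → Ω → ChState L D) (μ : ℕ → Ω → Fin M → Bool)
    {φ₀ : Fin N → ℕ} (hφ₀ : ∀ n, 1 ≤ φ₀ n) (t : ℕ) (ω : Ω) (n : Fin N) :
    1 ≤ aoi π h μ φ₀ t ω n := by
  cases t with
  | zero => exact hφ₀ n
  | succ t => rw [aoi_succ, nextAge]; split_ifs <;> simp

theorem aoi_congr (π : Policy N M L D) (h : ℕ → Ω → ChState L D) (μ : ℕ → Ω → Fin M → Bool)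
    (φ₀ : Fin N → ℕ) (t : ℕ) (ω ω' : Ω) (hω : ∀ s < t, h s ω = h s ω' ∧ μ s ω = μ s ω') :
    aoi π h μ φ₀ t ω = aoi π h μ φ₀ t ω' := by
  induction t with
  | zero => rfl
  | succ t ih =>
    obtain ⟨h1, h2⟩ := hω t t.lt_succ_self
    rw [aoi_succ, aoi_succ, ih fun s hs => hω s (hs.trans t.lt_succ_self), h1, h2]

end Ages

/-! ### A stabilizing policy -/

section Oldest

variable {N M : ℕ} {L : Fin M → ℕ} {D : ℕ}

/-- The number of sensors whose age is at least that of sensor `n`, including `n` itself. -/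
def ageRank (φ : Fin N → ℕ) (n : Fin N) : ℕ := (Finset.univ.filter fun m => φ n ≤ φ m).card

theorem ageRank_le (φ : Fin N → ℕ) (n : Fin N) : ageRank φ n ≤ N :=
  (Finset.card_le_univ _).trans (by simp)

/-- The weight of sensor `n`, exponential in its age and in its place in the queue. -/
noncomputable def queueWeight (r Λ : ℝ) (n : Fin N) (φ : Fin N → ℕ) : ℝ :=
  r ^ φ n * Λ ^ ageRank φ n

variable [NeZero N]

/-- A sensor with the largest age of information. Ties are broken in a fixed way, which depends on
the vector of ages only. -/
noncomputable def oldest (φ : Fin N → ℕ) : Fin N := (Finite.exists_max φ).choose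

theorem le_oldest (φ : Fin N → ℕ) (n : Fin N) : φ n ≤ φ (oldest φ) :=
  (Finite.exists_max φ).choose_spec n

/-- The policy that schedules only a sensor of largest age, at the frequency `v i`. -/
noncomputable def oldestFirst (v : ChState L D → Fin M) : Policy N M L D where
  act φ i n := if n = oldest φ then some (v i) else none
  feasible φ i n n' m h h' := by
    by_cases h1 : n = oldest φ <;> by_cases h2 : n' = oldest φ <;> simp_all

variable (v : ChState L D → Fin M) (φ : Fin N → ℕ) (i : ChState L D) (o : Fin M → Bool)

theorem nextAge_oldestFirst_of_fail (ho : o (v i) = false) (n : Fin N) :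
    nextAge (oldestFirst v) φ i o n = φ n + 1 := by
  unfold nextAge oldestFirst received
  by_cases h : n = oldest φ <;> simp [h, ho]

theorem nextAge_oldestFirst_of_success (ho : o (v i) = true) (n : Fin N) :
    nextAge (oldestFirst v) φ i o n = if n = oldest φ then 1 else φ n + 1 := by
  unfold nextAge oldestFirst received
  by_cases h : n = oldest φ <;> simp [h, ho]

theorem ageRank_nextAge_of_fail (ho : o (v i) = false) (n : Fin N) :
    ageRank (nextAge (oldestFirst v) φ i o) n = ageRank φ n := by
  simp [ageRank, nextAge_oldestFirst_of_fail v φ i o ho]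

/-- Each success of another sensor moves sensor `n` up the queue by one place. -/
theorem ageRank_nextAge_of_success (ho : o (v i) = true) {n : Fin N} (hn : n ≠ oldest φ)
    (hφ : 1 ≤ φ n) : ageRank (nextAge (oldestFirst v) φ i o) n + 1 ≤ ageRank φ n := by
  have hmem : oldest φ ∈ Finset.univ.filter fun m => φ n ≤ φ m := by simp [le_oldest]
  rw [ageRank, ageRank, ← Finset.card_erase_add_one hmem]
  refine Nat.succ_le_succ (Finset.card_le_card fun m hm => ?_)
  simp only [nextAge_oldestFirst_of_success v φ i o ho, if_neg hn, Finset.mem_filter,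
    Finset.mem_univ, true_and, Finset.mem_erase] at hm ⊢
  split_ifs at hm with h1
  · omega
  · exact ⟨h1, by omega⟩

theorem queueWeight_nextAge_le {r Λ : ℝ} (hr : 0 < r) (hΛ : 1 ≤ Λ) (n : Fin N) (hφ : 1 ≤ φ n) :
    queueWeight r Λ n (nextAge (oldestFirst v) φ i o) ≤
      (if o (v i) = false then r * queueWeight r Λ n φ else 0) +
        (r * queueWeight r Λ n φ / Λ + r * Λ ^ N) := by
  have hΛ0 : 0 < Λ := by linarith
  have hw : 0 ≤ queueWeight r Λ n φ := by unfold queueWeight; positivity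
  rcases Bool.eq_false_or_eq_true (o (v i)) with ho | ho
  · rw [if_neg (by simp [ho]), zero_add]
    by_cases hn : n = oldest φ
    · have h1 : queueWeight r Λ n (nextAge (oldestFirst v) φ i o) ≤ r * Λ ^ N := by
        rw [queueWeight, nextAge_oldestFirst_of_success v φ i o ho, if_pos hn, pow_one]
        gcongr
        exact ageRank_le _ _
      have h2 : 0 ≤ r * queueWeight r Λ n φ / Λ := by positivity
      linarith
    · have h1 : queueWeight r Λ n (nextAge (oldestFirst v) φ i o) ≤
          r * queueWeight r Λ n φ / Λ := by
        rw [le_div_iff₀ hΛ0, queueWeight, queueWeight, mul_assoc, ← pow_succ,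
          nextAge_oldestFirst_of_success v φ i o ho, if_neg hn, pow_succ', mul_assoc]
        gcongr
        exact ageRank_nextAge_of_success v φ i o ho hn hφ
      have h2 : 0 ≤ r * Λ ^ N := by positivity
      linarith
  · rw [if_pos ho]
    have h1 : queueWeight r Λ n (nextAge (oldestFirst v) φ i o) = r * queueWeight r Λ n φ := by
      rw [queueWeight, queueWeight, ageRank_nextAge_of_fail v φ i o ho,
        nextAge_oldestFirst_of_fail v φ i o ho, pow_succ']
      ring
    have h2 : 0 ≤ r * queueWeight r Λ n φ / Λ + r * Λ ^ N := by positivity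
    linarith

variable (ch : SemiMarkovChannel M L D)

/-- Foster–Lyapunov drift: a failure contracts the weight on average, through `y`; a success of
another sensor contracts it through the queue, by the factor `Λ`; a success of sensor `n` resets
it to a bounded value. -/
theorem queueWeight_drift {r Λ Y : ℝ} (hr : 0 < r) (hΛ : 1 ≤ Λ) {y : ChState L D → ℝ}
    (hy1 : ∀ i, 1 ≤ y i) (hyY : ∀ i, y i ≤ Y)
    (hy : ∀ i, r * ((ch.dropMatrix v * ch.augMatrix) *ᵥ y) i + 1 ≤ y i)
    (hΛy : ∀ i, 2 * (r * (ch.augMatrix *ᵥ y) i) ≤ Λ) (n : Fin N) (hφ : 1 ≤ φ n) :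
    ∑ o, ∑ j, ch.outcome i o * ch.augMatrix i j *
        (queueWeight r Λ n (nextAge (oldestFirst v) φ i o) * y j) ≤
      (1 - (2 * Y)⁻¹) * (queueWeight r Λ n φ * y i) + Λ ^ (N + 1) := by
  have hΛ0 : 0 < Λ := by linarith
  have hY : 0 < Y := by linarith [hy1 i, hyY i]
  set w := queueWeight r Λ n φ with hw
  have hw0 : 0 ≤ w := by rw [hw, queueWeight]; positivity
  set S := (ch.augMatrix *ᵥ y) i with hS
  have hS0 : 0 ≤ S := Finset.sum_nonneg fun j _ =>
    mul_nonneg (ch.augMatrix_nonneg i j) (zero_le_one.trans (hy1 j))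
  have h1 : ∑ o, ∑ j, ch.outcome i o * ch.augMatrix i j *
        (queueWeight r Λ n (nextAge (oldestFirst v) φ i o) * y j) =
      (∑ o, ch.outcome i o * queueWeight r Λ n (nextAge (oldestFirst v) φ i o)) * S := by
    rw [Finset.sum_mul]
    refine Finset.sum_congr rfl fun o _ => ?_
    rw [hS, Matrix.mulVec, dotProduct, Finset.mul_sum]
    exact Finset.sum_congr rfl fun j _ => by ring
  have h2 : ∑ o, ch.outcome i o * queueWeight r Λ n (nextAge (oldestFirst v) φ i o) ≤
      ch.drop i (v i) * (r * w) + (r * w / Λ + r * Λ ^ N) := by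
    calc _ ≤ ∑ o, ch.outcome i o * ((if o (v i) = false then r * w else 0) +
            (r * w / Λ + r * Λ ^ N)) := Finset.sum_le_sum fun o _ =>
          mul_le_mul_of_nonneg_left (queueWeight_nextAge_le v φ i o hr hΛ n hφ)
            (ch.outcome_nonneg i o)
      _ = _ := by
          simp_rw [mul_add (ch.outcome i _) (ite _ _ _)]
          rw [Finset.sum_add_distrib, ← Finset.sum_mul, ch.outcome_sum, one_mul,
            SemiMarkovChannel.drop, Finset.sum_mul]
          congr 1
          refine Finset.sum_congr rfl fun o _ => ?_
          split_ifs <;> simp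
  have h3 := hy i
  rw [ch.dropMatrix_mul_mulVec, ← hS] at h3
  have h4 : 2 * (r * S) ≤ Λ := hΛy i
  have h5 : w * (r * S / Λ) ≤ w * (1 / 2) := by
    refine mul_le_mul_of_nonneg_left ?_ hw0
    rw [div_le_iff₀ hΛ0]
    linarith
  have h6 : r * S * Λ ^ N ≤ Λ ^ (N + 1) := by
    rw [pow_succ']
    gcongr
    nlinarith
  have h7 : (2 * Y)⁻¹ * (w * y i) ≤ w * (1 / 2) := by
    have : (2 * Y)⁻¹ * y i ≤ 1 / 2 := by
      rw [inv_mul_le_iff₀ (by positivity)]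
      linarith [hyY i]
    calc (2 * Y)⁻¹ * (w * y i) = w * ((2 * Y)⁻¹ * y i) := by ring
      _ ≤ _ := by gcongr
  rw [h1]
  calc _ ≤ (ch.drop i (v i) * (r * w) + (r * w / Λ + r * Λ ^ N)) * S := by gcongr
    _ = w * (r * (ch.drop i (v i) * S)) + w * (r * S / Λ) + r * S * Λ ^ N := by ring
    _ ≤ w * (y i - 1) + w * (1 / 2) + Λ ^ (N + 1) := by
        gcongr
        linarith
    _ ≤ _ := by nlinarith

end Oldest

section Stability

variable {N M D : ℕ} {L : Fin M → ℕ} {ch : SemiMarkovChannel M L D} {Ω : Type*}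
  [MeasurableSpace Ω] {P : Measure Ω} [IsProbabilityMeasure P] {h : ℕ → Ω → ChState L D}
  {μ : ℕ → Ω → Fin M → Bool}

theorem avgCost_oldestFirst_lt_top [NeZero N] (proc : Fin N → LTIProcess)
    (hreal : ch.IsRealization P h μ) {φ₀ : Fin N → ℕ} (hφ₀ : ∀ n, 1 ≤ φ₀ n)
    (v : ChState L D → Fin M) {r : ℝ} (hr : 0 < r) (n : Fin N)
    (hrA : specRad (proc n).A ^ 2 < ENNReal.ofReal r)
    (hrB : ENNReal.ofReal r * specRad (ch.dropMatrix v * ch.augMatrix) < 1) :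
    avgCost proc P (oldestFirst v) h μ φ₀ n < ⊤ := by
  have : Nonempty Ω := nonempty_of_isProbabilityMeasure P
  have : Nonempty (ChState L D) := ‹Nonempty Ω›.map (h 0)
  obtain ⟨y, hy1, hy⟩ := exists_strict_superinvariant _ (ch.dropMatrix_mul_nonneg v) hr hrB
  obtain ⟨iY, hyY⟩ := Finite.exists_max y
  set Y := y iY with hY
  have hY1 : 1 ≤ Y := hy1 iY
  obtain ⟨iΛ, hiΛ⟩ := Finite.exists_max fun i => 2 * (r * (ch.augMatrix *ᵥ y) i)
  set Λ := max 1 (2 * (r * (ch.augMatrix *ᵥ y) iΛ)) with hΛ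
  have hΛ1 : 1 ≤ Λ := le_max_left _ _
  have hΛ0 : 0 < Λ := by linarith
  have hΛy : ∀ i, 2 * (r * (ch.augMatrix *ᵥ y) i) ≤ Λ := fun i => (hiΛ i).trans (le_max_right _ _)
  set V : (Fin N → ℕ) → ChState L D → ℝ := fun φ i => queueWeight r Λ n φ * y i with hV
  have hV0 : ∀ φ i, 0 ≤ V φ i := fun φ i =>
    mul_nonneg (by unfold queueWeight; positivity) (zero_le_one.trans (hy1 i))
  set E : ℕ → ℝ≥0∞ := fun t =>
    ∫⁻ ω, ENNReal.ofReal (V (aoi (oldestFirst v) h μ φ₀ t ω) (h t ω)) ∂P with hE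
  have hθ0 : 0 ≤ 1 - (2 * Y)⁻¹ := by
    have : (2 * Y)⁻¹ ≤ 1 := inv_le_one_of_one_le₀ (by linarith)
    linarith
  have hstep : ∀ t, E (t + 1) ≤
      ENNReal.ofReal (1 - (2 * Y)⁻¹) * E t + ENNReal.ofReal (Λ ^ (N + 1)) := by
    intro t
    calc E (t + 1) = ∫⁻ ω, ∑ o, ∑ j,
          ENNReal.ofReal (ch.outcome (h t ω) o * ch.augMatrix (h t ω) j) * ENNReal.ofReal
            (V (nextAge (oldestFirst v) (aoi (oldestFirst v) h μ φ₀ t ω) (h t ω) o) j) ∂P :=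
          hreal.lintegral_step t (aoi (oldestFirst v) h μ φ₀ t)
            (aoi_congr (oldestFirst v) h μ φ₀ t)
            fun φ i o j => ENNReal.ofReal (V (nextAge (oldestFirst v) φ i o) j)
      _ ≤ ∫⁻ ω, (ENNReal.ofReal (1 - (2 * Y)⁻¹) *
            ENNReal.ofReal (V (aoi (oldestFirst v) h μ φ₀ t ω) (h t ω)) +
              ENNReal.ofReal (Λ ^ (N + 1))) ∂P := by
          refine lintegral_mono fun ω => ?_
          have h0 : ∀ o j, 0 ≤ ch.outcome (h t ω) o * ch.augMatrix (h t ω) j := fun o j =>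
            mul_nonneg (ch.outcome_nonneg _ _) (ch.augMatrix_nonneg _ _)
          simp_rw [← ENNReal.ofReal_mul (h0 _ _)]
          rw [Finset.sum_congr rfl fun o _ => (ENNReal.ofReal_sum_of_nonneg fun j _ =>
              mul_nonneg (h0 o j) (hV0 _ j)).symm,
            ← ENNReal.ofReal_sum_of_nonneg fun o _ =>
              Finset.sum_nonneg fun j _ => mul_nonneg (h0 o j) (hV0 _ j),
            ← ENNReal.ofReal_mul hθ0,
            ← ENNReal.ofReal_add (mul_nonneg hθ0 (hV0 _ _)) (by positivity)]
          exact ENNReal.ofReal_le_ofReal (queueWeight_drift v _ _ ch hr hΛ1 hy1 hyY hy hΛy n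
            (one_le_aoi _ h μ hφ₀ t ω n))
      _ = _ := by
          rw [lintegral_add_right _ measurable_const, lintegral_const_mul' _ _ ENNReal.ofReal_ne_top]
          simp [hE]
  set K := max (queueWeight r Λ n φ₀ * Y) (2 * Y * Λ ^ (N + 1)) with hK
  have hK0 : 0 ≤ K := le_trans (by positivity) (le_max_right _ _)
  have hEK : ∀ t, E t ≤ ENNReal.ofReal K := by
    intro t
    induction t with
    | zero =>
      calc E 0 ≤ ∫⁻ _ω, ENNReal.ofReal K ∂P := lintegral_mono fun ω => by
            refine ENNReal.ofReal_le_ofReal (le_trans ?_ (le_max_left _ _))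
            exact mul_le_mul_of_nonneg_left (hyY _) (by unfold queueWeight; positivity)
        _ = ENNReal.ofReal K := by simp
    | succ t ih =>
      refine (hstep t).trans ?_
      calc _ ≤ ENNReal.ofReal (1 - (2 * Y)⁻¹) * ENNReal.ofReal K +
            ENNReal.ofReal (Λ ^ (N + 1)) := by gcongr
        _ = ENNReal.ofReal ((1 - (2 * Y)⁻¹) * K + Λ ^ (N + 1)) := by
            rw [← ENNReal.ofReal_mul hθ0,
              ← ENNReal.ofReal_add (mul_nonneg hθ0 hK0) (by positivity)]
        _ ≤ ENNReal.ofReal K := by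
            refine ENNReal.ofReal_le_ofReal ?_
            have h1 : 2 * Y * Λ ^ (N + 1) ≤ K := le_max_right _ _
            have h2 : Λ ^ (N + 1) ≤ (2 * Y)⁻¹ * K := by
              rwa [le_inv_mul_iff₀ (by linarith)]
            linarith
  obtain ⟨c, hc, hcost⟩ := (proc n).exists_cost_le hr hrA
  have hbound : ∀ t, ∫⁻ ω, ENNReal.ofReal ((proc n).cost (aoi (oldestFirst v) h μ φ₀ t ω n)) ∂P ≤
      ENNReal.ofReal c * (1 + ENNReal.ofReal K) := by
    intro t
    calc _ ≤ ∫⁻ ω, ENNReal.ofReal c *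
          (1 + ENNReal.ofReal (V (aoi (oldestFirst v) h μ φ₀ t ω) (h t ω))) ∂P := by
          refine lintegral_mono fun ω => ?_
          rw [← ENNReal.ofReal_one, ← ENNReal.ofReal_add zero_le_one (hV0 _ _),
            ← ENNReal.ofReal_mul hc]
          refine ENNReal.ofReal_le_ofReal ((hcost _).trans ?_)
          have h1 : r ^ aoi (oldestFirst v) h μ φ₀ t ω n ≤
              V (aoi (oldestFirst v) h μ φ₀ t ω) (h t ω) := by
            simp only [hV, queueWeight, mul_assoc]
            refine le_mul_of_one_le_right (by positivity) ?_
            exact one_le_mul_of_one_le_of_one_le (one_le_pow₀ hΛ1) (hy1 _)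
          gcongr
      _ = ENNReal.ofReal c * (1 + E t) := by
          rw [lintegral_const_mul' _ _ ENNReal.ofReal_ne_top, lintegral_add_left measurable_const]
          simp [hE]
      _ ≤ _ := by
          gcongr
          exact hEK t
  have hfin : ENNReal.ofReal c * (1 + ENNReal.ofReal K) < ⊤ :=
    ENNReal.mul_lt_top ENNReal.ofReal_lt_top
      (ENNReal.add_lt_top.2 ⟨ENNReal.one_lt_top, ENNReal.ofReal_lt_top⟩)
  refine lt_of_le_of_lt ?_ hfin
  refine limsup_le_of_le (by isBoundedDefault) (Eventually.of_forall fun T => ?_)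
  calc _ ≤ (T : ℝ≥0∞)⁻¹ * ∑ _t ∈ Finset.Icc 1 T, ENNReal.ofReal c * (1 + ENNReal.ofReal K) := by
        gcongr with t _
        exact hbound t
    _ = ((T : ℝ≥0∞)⁻¹ * T) * (ENNReal.ofReal c * (1 + ENNReal.ofReal K)) := by
        simp [mul_assoc]
    _ ≤ 1 * (ENNReal.ofReal c * (1 + ENNReal.ofReal K)) := by
        gcongr
        exact ENNReal.inv_mul_le_one _
    _ = _ := one_mul _

/-! ### Instability of every policy -/

/-- Whatever sensor `n` does, its packet is lost with probability at least `ch.drop i (v i)`. This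
yields a drift of the cost of an unstable mode, weighted with a subinvariant vector of the failure
matrix; the term `1` in `∑_{j ≤ k} s ^ j = s * ∑_{j < k} s ^ j + 1` gives the increment. -/
theorem weighted_geom_sum_drift (ch : SemiMarkovChannel M L D) (π : Policy N M L D)
    (v : ChState L D → Fin M) (hv : ∀ i m, ch.drop i (v i) ≤ ch.drop i m) {s β : ℝ} (hs : 0 ≤ s)
    (hsβ : 1 ≤ s * β) {x : ChState L D → ℝ} (hx0 : ∀ i, 0 ≤ x i)
    (hx : ∀ i, β * x i ≤ ((ch.dropMatrix v * ch.augMatrix) *ᵥ x) i) (φ : Fin N → ℕ)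
    (i : ChState L D) (n : Fin N) :
    (∑ j ∈ Finset.range (φ n), s ^ j) * x i + β * x i ≤
      ∑ o, ∑ j, ch.outcome i o * ch.augMatrix i j *
        ((∑ k ∈ Finset.range (nextAge π φ i o n), s ^ k) * x j) := by
  set a : ℕ → ℝ := fun k => ∑ j ∈ Finset.range k, s ^ j with ha
  have ha0 : ∀ k, 0 ≤ a k := fun k => by simp only [ha]; positivity
  have hasucc : a (φ n + 1) = s * a (φ n) + 1 := by
    simp only [ha]
    rw [Finset.sum_range_succ', Finset.mul_sum]
    simp [pow_succ']
  set S := (ch.augMatrix *ᵥ x) i with hS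
  have hS0 : 0 ≤ S := Finset.sum_nonneg fun j _ => mul_nonneg (ch.augMatrix_nonneg i j) (hx0 j)
  have h1 : ∑ o, ∑ j, ch.outcome i o * ch.augMatrix i j * (a (nextAge π φ i o n) * x j) =
      (∑ o, ch.outcome i o * a (nextAge π φ i o n)) * S := by
    rw [Finset.sum_mul]
    refine Finset.sum_congr rfl fun o _ => ?_
    rw [hS, Matrix.mulVec, dotProduct, Finset.mul_sum]
    exact Finset.sum_congr rfl fun j _ => by ring
  have h2 : ch.drop i (v i) * a (φ n + 1) ≤ ∑ o, ch.outcome i o * a (nextAge π φ i o n) := by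
    cases hact : π.act φ i n with
    | none =>
      have h3 : ∀ o, nextAge π φ i o n = φ n + 1 := fun o => by simp [nextAge, hact, received]
      simp_rw [h3]
      rw [← Finset.sum_mul, ch.outcome_sum]
      exact mul_le_mul_of_nonneg_right (ch.drop_le_one _ _) (ha0 _)
    | some m =>
      refine (mul_le_mul_of_nonneg_right (hv i m) (ha0 _)).trans ?_
      rw [SemiMarkovChannel.drop, Finset.sum_mul]
      refine Finset.sum_le_sum fun o _ => ?_
      split_ifs with ho
      · simp [nextAge, hact, received, ho]
      · rw [zero_mul]
        exact mul_nonneg (ch.outcome_nonneg i o) (ha0 _)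
  have h3 := hx i
  rw [ch.dropMatrix_mul_mulVec, ← hS] at h3
  refine le_trans ?_ (le_of_eq h1.symm)
  calc a (φ n) * x i + β * x i ≤ (s * β) * (a (φ n) * x i) + β * x i := by
        refine add_le_add ?_ le_rfl
        exact le_mul_of_one_le_left (mul_nonneg (ha0 _) (hx0 i)) hsβ
    _ = a (φ n + 1) * (β * x i) := by rw [hasucc]; ring
    _ ≤ a (φ n + 1) * (ch.drop i (v i) * S) := mul_le_mul_of_nonneg_left h3 (ha0 _)
    _ = ch.drop i (v i) * a (φ n + 1) * S := by ring
    _ ≤ _ := mul_le_mul_of_nonneg_right h2 hS0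

theorem limsup_average_eq_top {f : ℕ → ℝ≥0∞} (hf : Tendsto f atTop (nhds ⊤)) :
    limsup (fun T : ℕ => (T : ℝ≥0∞)⁻¹ * ∑ t ∈ Finset.Icc 1 T, f t) atTop = ⊤ := by
  refine Tendsto.limsup_eq ?_
  rw [ENNReal.tendsto_nhds_top_iff_nat]
  intro n
  obtain ⟨t₀, ht₀⟩ := eventually_atTop.1
    (ENNReal.tendsto_nhds_top_iff_nat.1 hf (2 * (n + 1)))
  filter_upwards [eventually_ge_atTop (2 * t₀ + 1)] with T hT
  have hT0 : (T : ℝ≥0∞) ≠ 0 := by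
    rw [Nat.cast_ne_zero]; omega
  have h1 : (T : ℝ≥0∞) * (n + 1 : ℕ) ≤ ∑ t ∈ Finset.Icc 1 T, f t := by
    calc (T : ℝ≥0∞) * (n + 1 : ℕ) ≤ ((T - t₀ : ℕ) * (2 * (n + 1) : ℕ) : ℝ≥0∞) := by
          have : T * (n + 1) ≤ (T - t₀) * (2 * (n + 1)) := by
            rw [← mul_assoc]
            exact Nat.mul_le_mul_right _ (by omega)
          exact_mod_cast this
      _ = ∑ _t ∈ Finset.Icc (t₀ + 1) T, ((2 * (n + 1) : ℕ) : ℝ≥0∞) := by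
          rw [Finset.sum_const, Nat.card_Icc, nsmul_eq_mul]
          congr 2
          omega
      _ ≤ ∑ t ∈ Finset.Icc (t₀ + 1) T, f t := Finset.sum_le_sum fun t ht =>
          (ht₀ t (by have := (Finset.mem_Icc.1 ht).1; omega)).le
      _ ≤ _ := Finset.sum_le_sum_of_subset (Finset.Icc_subset_Icc_left (by omega))
  calc (n : ℝ≥0∞) < (n + 1 : ℕ) := by exact_mod_cast n.lt_succ_self
    _ = (T : ℝ≥0∞)⁻¹ * (T * (n + 1 : ℕ)) := by
        rw [← mul_assoc, ENNReal.inv_mul_cancel hT0 (ENNReal.natCast_ne_top T), one_mul]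
    _ ≤ _ := by gcongr

theorem avgCost_eq_top (proc : Fin N → LTIProcess) (hreal : ch.IsRealization P h μ)
    (hirr : ch.augMatrix.IsIrreducible) (φ₀ : Fin N → ℕ) (v : ChState L D → Fin M)
    (hv : ∀ i m, ch.drop i (v i) ≤ ch.drop i m) (π : Policy N M L D) (n : Fin N)
    (hproc : (proc n).StableSteadyKalman) (hA : 1 ≤ specRad (proc n).A)
    (hAB : 1 ≤ specRad (proc n).A ^ 2 * specRad (ch.dropMatrix v * ch.augMatrix)) :
    avgCost proc P π h μ φ₀ n = ⊤ := by
  have : Nonempty Ω := nonempty_of_isProbabilityMeasure P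
  have : Nonempty (ChState L D) := ‹Nonempty Ω›.map (h 0)
  obtain ⟨x, hx0, hxpos, hx⟩ := exists_subinvariant _ (ch.dropMatrix_mul_nonneg v)
  set β := (specRad (ch.dropMatrix v * ch.augMatrix)).toReal with hβ
  set s := (specRad (proc n).A).toReal ^ 2 with hs
  have hs0 : 0 ≤ s := by positivity
  have hsβ : 1 ≤ s * β := by
    have := ENNReal.toReal_mono (ENNReal.mul_ne_top (ENNReal.pow_ne_top (specRad_ne_top _))
      (specRad_ne_top _)) hAB
    rwa [ENNReal.toReal_one, ENNReal.toReal_mul, ENNReal.toReal_pow] at this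
  have hβ0 : 0 < β := by
    by_contra! hcon
    have : s * β ≤ 0 := mul_nonpos_of_nonneg_of_nonpos hs0 hcon
    linarith
  obtain ⟨c, hc, hcost⟩ := LTIProcess.exists_le_cost hproc hA
  obtain ⟨iX, hiX⟩ := Finite.exists_max x
  have hX0 : 0 < x iX := by
    obtain ⟨i, hi⟩ := hxpos
    exact hi.trans_le (hiX i)
  set U : (Fin N → ℕ) → ChState L D → ℝ :=
    fun φ i => (∑ k ∈ Finset.range (φ n), s ^ k) * x i with hU
  have hU0 : ∀ φ i, 0 ≤ U φ i := fun φ i => mul_nonneg (by positivity) (hx0 i)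
  set E : ℕ → ℝ≥0∞ := fun t => ∫⁻ ω, ENNReal.ofReal (U (aoi π h μ φ₀ t ω) (h t ω)) ∂P with hE
  have hstep : ∀ t, E t + ENNReal.ofReal β * ∫⁻ ω, ENNReal.ofReal (x (h t ω)) ∂P ≤ E (t + 1) := by
    intro t
    have hxm : Measurable fun ω => ENNReal.ofReal β * ENNReal.ofReal (x (h t ω)) :=
      (Measurable.of_discrete (f := fun i => ENNReal.ofReal β * ENNReal.ofReal (x i))).comp
        (hreal.measurable_state t)
    calc E t + ENNReal.ofReal β * ∫⁻ ω, ENNReal.ofReal (x (h t ω)) ∂P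
        = ∫⁻ ω, (ENNReal.ofReal (U (aoi π h μ φ₀ t ω) (h t ω)) +
            ENNReal.ofReal β * ENNReal.ofReal (x (h t ω))) ∂P := by
          rw [lintegral_add_right _ hxm, lintegral_const_mul' _ _ ENNReal.ofReal_ne_top]
      _ ≤ ∫⁻ ω, ∑ o, ∑ j, ENNReal.ofReal (ch.outcome (h t ω) o * ch.augMatrix (h t ω) j) *
            ENNReal.ofReal (U (nextAge π (aoi π h μ φ₀ t ω) (h t ω) o) j) ∂P := by
          refine lintegral_mono fun ω => ?_
          have h0 : ∀ o j, 0 ≤ ch.outcome (h t ω) o * ch.augMatrix (h t ω) j := fun o j =>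
            mul_nonneg (ch.outcome_nonneg _ _) (ch.augMatrix_nonneg _ _)
          simp_rw [← ENNReal.ofReal_mul (h0 _ _)]
          rw [Finset.sum_congr rfl fun o _ => (ENNReal.ofReal_sum_of_nonneg fun j _ =>
              mul_nonneg (h0 o j) (hU0 _ j)).symm,
            ← ENNReal.ofReal_sum_of_nonneg fun o _ =>
              Finset.sum_nonneg fun j _ => mul_nonneg (h0 o j) (hU0 _ j),
            ← ENNReal.ofReal_mul hβ0.le,
            ← ENNReal.ofReal_add (hU0 _ _) (mul_nonneg hβ0.le (hx0 _))]
          exact ENNReal.ofReal_le_ofReal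
            (weighted_geom_sum_drift ch π v hv hs0 hsβ hx0 hx _ _ n)
      _ = E (t + 1) :=
          (hreal.lintegral_step t (aoi π h μ φ₀ t) (aoi_congr π h μ φ₀ t)
            fun φ i o j => ENNReal.ofReal (U (nextAge π φ i o) j)).symm
  have hsum : ∀ t, ENNReal.ofReal β *
      ∑ k ∈ Finset.range t, ∫⁻ ω, ENNReal.ofReal (x (h k ω)) ∂P ≤ E t := by
    intro t
    induction t with
    | zero => simp
    | succ t ih =>
      rw [Finset.sum_range_succ, mul_add]
      exact (add_le_add_left ih _).trans (hstep t)
  have hcostE : ∀ t, ENNReal.ofReal (c / x iX) * E t ≤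
      ∫⁻ ω, ENNReal.ofReal ((proc n).cost (aoi π h μ φ₀ t ω n)) ∂P := by
    intro t
    rw [hE, ← lintegral_const_mul' _ _ ENNReal.ofReal_ne_top]
    refine lintegral_mono fun ω => ?_
    rw [← ENNReal.ofReal_mul (by positivity)]
    refine ENNReal.ofReal_le_ofReal (le_trans ?_ (hcost _))
    rw [hU, div_mul_eq_mul_div, div_le_iff₀ hX0, ← mul_assoc]
    exact mul_le_mul_of_nonneg_left (hiX _) (by positivity)
  refine limsup_average_eq_top ?_
  have hlim : Tendsto (fun t => ENNReal.ofReal (c / x iX) * (ENNReal.ofReal β *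
      ∑ k ∈ Finset.range t, ∫⁻ ω, ENNReal.ofReal (x (h k ω)) ∂P)) atTop (nhds ⊤) := by
    have h1 := ENNReal.Tendsto.const_mul (a := ENNReal.ofReal β)
      (hreal.tendsto_sum_lintegral hirr hx0 hxpos) (Or.inl ENNReal.top_ne_zero)
    rw [ENNReal.mul_top (by simpa using hβ0)] at h1
    have h2 := ENNReal.Tendsto.const_mul (a := ENNReal.ofReal (c / x iX)) h1
      (Or.inl ENNReal.top_ne_zero)
    rwa [ENNReal.mul_top (by simpa using div_pos hc hX0)] at h2
  exact tendsto_nhds_top_mono' hlim fun t => (mul_le_mul_right (hsum t) _).trans (hcostE t)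

end Stability

end RemoteEstimation

theorem theorem1 {N M D : ℕ} (hM : 0 < M) (hMN : M < N) {L : Fin M → ℕ}
    (proc : Fin N → RemoteEstimation.LTIProcess)
    (hproc : ∀ n, (proc n).StableSteadyKalman)
    (ch : RemoteEstimation.SemiMarkovChannel M L D)
    (hirr : ch.augMatrix.IsIrreducible)
    (haper : RemoteEstimation.Aperiodic ch.augMatrix)
    {Ω : Type*} [MeasurableSpace Ω] (P : MeasureTheory.Measure Ω)
    [MeasureTheory.IsProbabilityMeasure P]
    (h : ℕ → Ω → RemoteEstimation.ChState L D) (μ : ℕ → Ω → Fin M → Bool)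
    (hreal : ch.IsRealization P h μ)
    (φ₀ : Fin N → ℕ) (hφ₀ : ∀ n, 1 ≤ φ₀ n)
    (v : RemoteEstimation.ChState L D → Fin M)
    (hv : ∀ i m, ch.drop i (v i) ≤ ch.drop i m) :
    (∃ π : RemoteEstimation.Policy N M L D,
        RemoteEstimation.AvgMeanSquareStable proc P π h μ φ₀) ↔
      (⨆ n, RemoteEstimation.specRad (proc n).A) ^ 2 *
        RemoteEstimation.specRad (ch.dropMatrix v * ch.augMatrix) < 1 := by
  have : NeZero N := ⟨by omega⟩
  have : Nonempty Ω := nonempty_of_isProbabilityMeasure P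
  have : Nonempty (RemoteEstimation.ChState L D) := ‹Nonempty Ω›.map (h 0)
  obtain ⟨n₀, hn₀⟩ := Finite.exists_max fun n => RemoteEstimation.specRad (proc n).A
  have hsup : ⨆ n, RemoteEstimation.specRad (proc n).A = RemoteEstimation.specRad (proc n₀).A :=
    le_antisymm (iSup_le hn₀) (le_iSup (fun n => RemoteEstimation.specRad (proc n).A) n₀)
  rw [hsup]
  constructor
  · rintro ⟨π, hπ⟩
    by_contra! hcon
    have hβ := ch.specRad_dropMatrix_mul_le_one v
    have hA : 1 ≤ RemoteEstimation.specRad (proc n₀).A := by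
      by_contra! hlt
      have h1 : RemoteEstimation.specRad (proc n₀).A ^ 2 < 1 := pow_lt_one₀ zero_le hlt two_ne_zero
      exact absurd hcon (not_le.2 ((mul_le_of_le_one_right zero_le hβ).trans_lt h1))
    have htop := RemoteEstimation.avgCost_eq_top proc hreal hirr φ₀ v hv π n₀ (hproc n₀) hA hcon
    have hle := Finset.single_le_sum
      (f := fun n => RemoteEstimation.avgCost proc P π h μ φ₀ n) (fun _ _ => zero_le)
      (Finset.mem_univ n₀)
    rw [RemoteEstimation.AvgMeanSquareStable] at hπ
    simp only [htop, top_le_iff] at hle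
    exact absurd hle hπ.ne
  · intro hlt
    have h1 : RemoteEstimation.specRad (proc n₀).A ^ 2 <
        (RemoteEstimation.specRad (ch.dropMatrix v * ch.augMatrix))⁻¹ := by
      rw [← one_div, ENNReal.lt_div_iff_mul_lt]
      · exact hlt
      · exact Or.inr (ENNReal.pow_ne_top (RemoteEstimation.specRad_ne_top _))
      · exact Or.inl (RemoteEstimation.specRad_ne_top _)
    obtain ⟨r, hr1, hr2⟩ := ENNReal.lt_iff_exists_nnreal_btwn.1 h1
    have hr0 : (0 : ℝ) < r := by exact_mod_cast (zero_le.trans_lt hr1 : (0 : ℝ≥0∞) < r)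
    have hr3 : ENNReal.ofReal r * RemoteEstimation.specRad (ch.dropMatrix v * ch.augMatrix) < 1 := by
      rw [ENNReal.ofReal_coe_nnreal]
      rw [← one_div, ENNReal.lt_div_iff_mul_lt] at hr2
      · exact hr2
      · exact Or.inr ENNReal.coe_ne_top
      · exact Or.inl (RemoteEstimation.specRad_ne_top _)
    refine ⟨RemoteEstimation.oldestFirst v, ENNReal.sum_lt_top.2 fun n _ => ?_⟩
    refine RemoteEstimation.avgCost_oldestFirst_lt_top proc hreal hφ₀ v hr0 n ?_ hr3
    rw [ENNReal.ofReal_coe_nnreal]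
    exact (pow_le_pow_left₀ zero_le (hn₀ n) 2).trans_lt hr1
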